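/- For $n\ge 0$ and $p\in[0,1]$ let $G(n,p)$ be the random graph on $n$ labelled vertices in which each of the $\binom n2$ possible edges is present independently with probability $p$. Let $X(n,p)$ be its clique complex, i.e. the simplicial complex whose faces are the nonempty sets of vertices that span a complete subgraph of $G(n,p)$. For $k\ge 0$ write $\beta_k(X(n,p))=\dim_{\mathbb Q}H_k(X(n,p);\mathbb Q)$ for its $k$-th Betti number. Theorem. Fix an integer $k>0$ and let $p=p(n)\in[0,1]$ satisfy $p=\omega(n^{-1/k})$ and $p=o(n^{-1/(k+1)})$ as $n\to\infty$, that is, $n^{1/k}p(n)\to\infty$ and $n^{1/(k+1)}p(n)\to 0$. Then, as $n\to\infty$, $$\frac{\beta_k(X(n,p))-\mathbb E[\beta_k(X(n,p))]}{\sqrt{\operatorname{Var}[\beta_k(X(n,p))]}}\Rightarrow\mathcal N(0,1),$$ where $\Rightarrow$ denotes weak convergence (convergence in distribution) and $\mathcal N(0,1)$ is the standard normal distribution. -/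

import Mathlib

open Filter MeasureTheory ProbabilityTheory Asymptotics

namespace AbstractSimplicialComplex

variable {V : Type*}

/-- The `k`-dimensional faces of `K`, i.e. the faces with `k + 1` vertices. -/
abbrev Face (K : AbstractSimplicialComplex V) (k : ℕ) : Type _ :=
  {s : Finset V // s ∈ K.faces ∧ s.card = k + 1}

/-- The rational simplicial `k`-chains of `K`. -/
abbrev Chain (K : AbstractSimplicialComplex V) (k : ℕ) : Type _ := K.Face k →₀ ℚ

variable [LinearOrder V]

/-- The facet of a `(k + 1)`-face opposite to one of its vertices. -/
def Face.facet {K : AbstractSimplicialComplex V} {k : ℕ} (s : K.Face (k + 1)) (v : s.1) :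
    K.Face k :=
  ⟨s.1.erase v.1, by
    have hc : (s.1.erase v.1).card = k + 1 := by
      rw [Finset.card_erase_of_mem v.2, s.2.2]; rfl
    exact ⟨(K.isRelLowerSet_faces s.2.1).2 (Finset.erase_subset _ _)
      (Finset.card_pos.1 (by omega)), hc⟩⟩

/-- The sign `(-1)^i` of a vertex `v` of `s`, where `i` is the (zero-based) position of `v` among
the vertices of `s` in increasing order. -/
def vertexSign (s : Finset V) (v : V) : ℚ := (-1) ^ (s.filter (· < v)).card

/-- The simplicial boundary operator `∂ : C_{k+1} → C_k`,
`∂[v_0, …, v_{k+1}] = ∑ i, (-1)^i [v_0, …, v̂_i, …, v_{k+1}]` for `v_0 < … < v_{k+1}`. -/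
noncomputable def boundary (K : AbstractSimplicialComplex V) (k : ℕ) :
    K.Chain (k + 1) →ₗ[ℚ] K.Chain k :=
  Finsupp.linearCombination ℚ fun s : K.Face (k + 1) =>
    ∑ v : s.1, Finsupp.single (s.facet v) (vertexSign s.1 v.1)

/-- The `k`-cycles; every `0`-chain is a cycle (unreduced homology). -/
noncomputable def cycles (K : AbstractSimplicialComplex V) : (k : ℕ) → Submodule ℚ (K.Chain k)
  | 0 => ⊤
  | k + 1 => LinearMap.ker (K.boundary k)

/-- The `k`-boundaries. -/
noncomputable def boundaries (K : AbstractSimplicialComplex V) (k : ℕ) :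
    Submodule ℚ (K.Chain k) :=
  LinearMap.range (K.boundary k)

theorem vertexSign_erase (s : Finset V) (v w : V) (hv : v ∈ s) (hvw : v < w) :
    vertexSign s v * vertexSign (s.erase v) w = -(vertexSign s w * vertexSign (s.erase w) v) := by
  have h1 : (s.erase v).filter (· < w) = (s.filter (· < w)).erase v := by
    ext x; simp only [Finset.mem_filter, Finset.mem_erase]; tauto
  have h2 : (s.erase w).filter (· < v) = s.filter (· < v) := by
    ext x; simp only [Finset.mem_filter, Finset.mem_erase]
    constructor
    · tauto
    · rintro ⟨hx, hxv⟩
      exact ⟨⟨(hxv.trans hvw).ne, hx⟩, hxv⟩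
  have hm : v ∈ s.filter (· < w) := Finset.mem_filter.2 ⟨hv, hvw⟩
  have h3 := Finset.card_erase_add_one hm
  unfold vertexSign
  rw [h1, h2, ← h3, pow_succ]
  ring

/-- The boundary of a boundary vanishes. -/
theorem boundary_comp_boundary (K : AbstractSimplicialComplex V) (k : ℕ) :
    K.boundary k ∘ₗ K.boundary (k + 1) = 0 := by
  ext1 s
  ext1
  simp only [LinearMap.coe_comp, Function.comp_apply, Finsupp.lsingle_apply, boundary,
    Finsupp.linearCombination_single, one_smul, map_sum, LinearMap.zero_apply,
    LinearMap.zero_comp, Finset.smul_sum, Finsupp.smul_single, smul_eq_mul]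
  rw [Finset.sum_sigma']
  refine Finset.sum_involution
    (fun x _ => ⟨⟨x.2.1, Finset.mem_of_mem_erase x.2.2⟩,
      ⟨x.1.1, Finset.mem_erase.2 ⟨(Finset.ne_of_mem_erase x.2.2).symm, x.1.2⟩⟩⟩)
    ?_ ?_ (fun _ _ => Finset.mem_sigma.2 ⟨Finset.mem_univ _, Finset.mem_univ _⟩)
    (fun _ _ => rfl)
  · rintro ⟨v, w⟩ _
    have hne : w.1 ≠ v.1 := Finset.ne_of_mem_erase w.2
    have hw : w.1 ∈ s.1 := Finset.mem_of_mem_erase w.2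
    have hf : (s.facet ⟨w.1, hw⟩).facet ⟨v.1, Finset.mem_erase.2 ⟨hne.symm, v.2⟩⟩ =
        (s.facet v).facet w := Subtype.ext Finset.erase_right_comm
    dsimp only
    rw [hf, ← Finsupp.single_add]
    have key : vertexSign s.1 v.1 * vertexSign (s.1.erase v.1) w.1 =
        -(vertexSign s.1 w.1 * vertexSign (s.1.erase w.1) v.1) := by
      rcases lt_or_gt_of_ne hne with h | h
      · rw [vertexSign_erase s.1 w.1 v.1 hw h, neg_neg]
      · exact vertexSign_erase s.1 v.1 w.1 v.2 h
    change Finsupp.single _ (vertexSign s.1 v.1 * vertexSign (s.1.erase v.1) w.1 +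
      vertexSign s.1 w.1 * vertexSign (s.1.erase w.1) v.1) = 0
    rw [key, neg_add_cancel, Finsupp.single_zero]
  · rintro ⟨v, w⟩ _ _ h
    have h1 := congrArg (fun x => (x.1 : V)) h
    exact Finset.ne_of_mem_erase w.2 h1

theorem boundaries_le_cycles (K : AbstractSimplicialComplex V) (k : ℕ) :
    K.boundaries k ≤ K.cycles k := by
  cases k with
  | zero => exact le_top
  | succ k =>
    rintro _ ⟨x, rfl⟩
    exact LinearMap.congr_fun (K.boundary_comp_boundary k) x

/-- The `k`-th simplicial homology `H_k(K; ℚ)`. -/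
abbrev Homology (K : AbstractSimplicialComplex V) (k : ℕ) : Type _ :=
  K.cycles k ⧸ (K.boundaries k).submoduleOf (K.cycles k)

/-- The `k`-th Betti number `dim H_k(K; ℚ)`. -/
noncomputable def betti (K : AbstractSimplicialComplex V) (k : ℕ) : ℕ :=
  Module.finrank ℚ (K.Homology k)

end AbstractSimplicialComplex

/-- The clique complex of a graph: its faces are the nonempty finite sets of vertices that span a
complete subgraph. -/
def SimpleGraph.cliqueComplex {V : Type*} (G : SimpleGraph V) : AbstractSimplicialComplex V where
  faces := {s | s.Nonempty ∧ G.IsClique (s : Set V)}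
  isRelLowerSet_faces := fun _ hs =>
    ⟨hs.1, fun _ hts ht => ⟨ht, hs.2.subset (Finset.coe_subset.2 hts)⟩⟩
  singleton_mem v := ⟨Finset.singleton_nonempty v, by simp⟩

/-- `β_k` of the clique complex, as a real-valued function of a graph on `n` vertices; under
`SimpleGraph.binomialRandom (Fin n) p` it is the random variable `β_k(X(n, p))`. -/
noncomputable def cliqueBetti (n k : ℕ) (G : SimpleGraph (Fin n)) : ℝ :=
  (G.cliqueComplex.betti k : ℝ)

/-! Write k = i + 1 and x = p(n). Let f_j be the number of cliques on j + 1 vertices, r_j the rank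
of the boundary operator on their span and z_j = f_j - r_j its nullity, so that β_k = z_k - r_{k+1}.
In the given regime β_k is, to leading order, an affine function of the number of edges #E. With m
the expected number of k-faces created by a fixed edge, the variance of β_k - m·#E is o(m² Var #E).
Since #E is binomial with variance tending to infinity, it is asymptotically normal, and L²
closeness passes this on to β_k after normalization.

The Efron–Stein inequality `bernoulliMean_sq_sub_sq_le` reduces the variance bound to showing that
the discrete derivative D_e β_k is close to m in mean square. Here D_e β_k - m = (D_e f_k - m) - D_e
r_k - D_e r_{k+1}. The first term is a second-moment computation, with relative error of order 1/(n
x^k). The third is dominated by D_e f_{k+1}, whose second moment is o(m²) because n x^{k+1} and x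
tend to 0.

The middle term has no local description and is treated globally. The nullity z_k is supermodular in
the edge set (`cliqueNullity_supermodular`), so its mean is convex in x. Moreover f_k - f_{k-1} ≤
z_k ≤ f_k, and E f_{k-1} / E f_k is O(1/(n x^k)). A convex function this close to E f_k has nearly
the slope of E f_k, so the derivatives D_e r_k have small total mean
(`sum_mean_discreteDeriv_cliqueRank_le`). As 0 ≤ D_e r_k ≤ D_e f_k and D_e f_k is concentrated at m,
this first moment controls the second. -/

set_option linter.unusedSectionVars false

/-! ### Random subsets: means, Efron–Stein, and convexity from supermodularity. -/

namespace Finset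

variable {α : Type*} [DecidableEq α] {E : Type*} [AddCommGroup E] [Module ℝ E]

/-- The mean of `F` over the random subset of `U` which contains every element of `U` independently
with probability `x`. -/
noncomputable def bernoulliMean (U : Finset α) (x : ℝ) (F : Finset α → E) : E :=
  ∑ S ∈ U.powerset, (x ^ #S * (1 - x) ^ (#U - #S)) • F S

/-- The discrete derivative of a set function in the direction of an element. -/
def discreteDeriv (e : α) (F : Finset α → E) (S : Finset α) : E :=
  F (insert e S) - F (S.erase e)

theorem bernoulliMean_empty (x : ℝ) (F : Finset α → E) : bernoulliMean ∅ x F = F ∅ := by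
  simp [bernoulliMean]

theorem bernoulliMean_insert {U : Finset α} {a : α} (ha : a ∉ U) (x : ℝ) (F : Finset α → E) :
    bernoulliMean (insert a U) x F =
      x • bernoulliMean U x (fun S => F (insert a S)) + (1 - x) • bernoulliMean U x F := by
  unfold bernoulliMean
  rw [sum_powerset_insert ha, add_comm, smul_sum, smul_sum]
  congr 1
  · refine sum_congr rfl fun S hS => ?_
    have haS : a ∉ S := fun h => ha (mem_powerset.1 hS h)
    rw [card_insert_of_notMem ha, card_insert_of_notMem haS, smul_smul, Nat.add_sub_add_right,
      pow_succ]
    ring_nf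
  · refine sum_congr rfl fun S hS => ?_
    have hc := card_le_card (mem_powerset.1 hS)
    rw [card_insert_of_notMem ha, smul_smul, Nat.sub_add_comm hc, pow_succ]
    ring_nf

theorem bernoulliMean_congr {U : Finset α} (x : ℝ) {F G : Finset α → E}
    (h : ∀ S ⊆ U, F S = G S) : bernoulliMean U x F = bernoulliMean U x G :=
  sum_congr rfl fun S hS => by rw [h S (mem_powerset.1 hS)]

theorem bernoulliMean_add (U : Finset α) (x : ℝ) (F G : Finset α → E) :
    bernoulliMean U x (fun S => F S + G S) = bernoulliMean U x F + bernoulliMean U x G := by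
  simp [bernoulliMean, smul_add, sum_add_distrib]

theorem bernoulliMean_sub (U : Finset α) (x : ℝ) (F G : Finset α → E) :
    bernoulliMean U x (fun S => F S - G S) = bernoulliMean U x F - bernoulliMean U x G := by
  simp [bernoulliMean, smul_sub, sum_sub_distrib]

theorem bernoulliMean_mul_left (U : Finset α) (x c : ℝ) (F : Finset α → ℝ) :
    bernoulliMean U x (fun S => c * F S) = c * bernoulliMean U x F := by
  simp only [bernoulliMean, smul_eq_mul, mul_sum]
  exact sum_congr rfl fun S _ => by ring

theorem bernoulliMean_sum {ι : Type*} (s : Finset ι) (U : Finset α) (x : ℝ)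
    (F : ι → Finset α → E) :
    bernoulliMean U x (fun S => ∑ i ∈ s, F i S) = ∑ i ∈ s, bernoulliMean U x (F i) := by
  simp only [bernoulliMean, smul_sum]
  exact sum_comm

theorem bernoulliMean_const (U : Finset α) (x : ℝ) (c : E) :
    bernoulliMean U x (fun _ => c) = c := by
  induction U using Finset.induction_on with
  | empty => exact bernoulliMean_empty _ _
  | insert a U ha ih => rw [bernoulliMean_insert ha, ih, ← add_smul]; simp

theorem bernoulliMean_mono {U : Finset α} {x : ℝ} (hx0 : 0 ≤ x) (hx1 : x ≤ 1)
    {F G : Finset α → ℝ} (h : ∀ S ⊆ U, F S ≤ G S) : bernoulliMean U x F ≤ bernoulliMean U x G :=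
  sum_le_sum fun S hS => mul_le_mul_of_nonneg_left (h S (mem_powerset.1 hS))
    (mul_nonneg (pow_nonneg hx0 _) (pow_nonneg (by linarith) _))

theorem bernoulliMean_nonneg {U : Finset α} {x : ℝ} (hx0 : 0 ≤ x) (hx1 : x ≤ 1)
    {F : Finset α → ℝ} (h : ∀ S ⊆ U, 0 ≤ F S) : 0 ≤ bernoulliMean U x F := by
  rw [← bernoulliMean_const U x (0 : ℝ)]
  exact bernoulliMean_mono hx0 hx1 h

theorem sq_bernoulliMean_le {U : Finset α} {x : ℝ} (hx0 : 0 ≤ x) (hx1 : x ≤ 1)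
    (F : Finset α → ℝ) : bernoulliMean U x F ^ 2 ≤ bernoulliMean U x (fun S => F S ^ 2) := by
  set c := bernoulliMean U x F with hc
  have h : 0 ≤ bernoulliMean U x (fun S => (F S - c) ^ 2) :=
    bernoulliMean_nonneg hx0 hx1 fun S _ => sq_nonneg _
  have h2 : bernoulliMean U x (fun S => (F S - c) ^ 2) =
      bernoulliMean U x (fun S => F S ^ 2) - c ^ 2 := by
    have : (fun S => (F S - c) ^ 2) = fun S => (F S ^ 2 - 2 * c * F S) + c ^ 2 := by
      ext S; ring
    rw [this, bernoulliMean_add, bernoulliMean_sub, bernoulliMean_mul_left, bernoulliMean_const,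
      ← hc]
    ring
  linarith

theorem discreteDeriv_comp_insert {a e : α} (hae : a ≠ e) (F : Finset α → E) (S : Finset α) :
    discreteDeriv e (fun T => F (insert a T)) S = discreteDeriv e F (insert a S) := by
  simp only [discreteDeriv]
  rw [erase_insert_of_ne hae, insert_comm]

/-- The derivative in direction `a` does not see whether `a` is present, so the coin of `a` averages
out. -/
theorem bernoulliMean_insert_discreteDeriv {U : Finset α} {a : α} (ha : a ∉ U) (x : ℝ)
    (φ : E → E) (F : Finset α → E) :
    bernoulliMean (insert a U) x (fun S => φ (discreteDeriv a F S)) =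
      bernoulliMean U x (fun S => φ (F (insert a S) - F S)) := by
  rw [bernoulliMean_insert ha]
  have h1 : bernoulliMean U x (fun S => φ (discreteDeriv a F (insert a S))) =
      bernoulliMean U x (fun S => φ (F (insert a S) - F S)) :=
    bernoulliMean_congr _ fun S hS => by
      simp [discreteDeriv, erase_eq_of_notMem fun h => ha (hS h)]
  have h2 : bernoulliMean U x (fun S => φ (discreteDeriv a F S)) =
      bernoulliMean U x (fun S => φ (F (insert a S) - F S)) :=
    bernoulliMean_congr _ fun S hS => by
      simp [discreteDeriv, erase_eq_of_notMem fun h => ha (hS h)]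
  rw [h1, h2, ← add_smul]
  simp

/-- The **Efron–Stein inequality** for functions of independent Bernoulli variables. -/
theorem bernoulliMean_sq_sub_sq_le {x : ℝ} (hx0 : 0 ≤ x) (hx1 : x ≤ 1) (U : Finset α)
    (F : Finset α → ℝ) :
    bernoulliMean U x (fun S => F S ^ 2) - bernoulliMean U x F ^ 2 ≤
      x * (1 - x) * ∑ e ∈ U, bernoulliMean U x (fun S => discreteDeriv e F S ^ 2) := by
  induction U using Finset.induction_on generalizing F with
  | empty => simp [bernoulliMean_empty]
  | insert a U ha ih =>
    have i1 := mul_le_mul_of_nonneg_left (ih fun S => F (insert a S)) hx0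
    have i0 := mul_le_mul_of_nonneg_left (ih F) (sub_nonneg.2 hx1)
    -- Conditioning on `a` splits the variance into the average conditional variance plus `x (1 -
    -- x)` times the squared difference of the conditional means. Jensen bounds the latter by the
    -- term of `a`.
    have hs := sq_bernoulliMean_le (U := U) hx0 hx1 (fun S => F (insert a S) - F S)
    rw [bernoulliMean_sub] at hs
    have hs' := mul_le_mul_of_nonneg_left hs (mul_nonneg hx0 (sub_nonneg.2 hx1))
    rw [sum_insert ha, bernoulliMean_insert_discreteDeriv ha x (fun y => y ^ 2)]
    have hsum : ∑ e ∈ U, bernoulliMean (insert a U) x (fun S => discreteDeriv e F S ^ 2) =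
        x * ∑ e ∈ U, bernoulliMean U x
          (fun S => discreteDeriv e (fun T => F (insert a T)) S ^ 2) +
        (1 - x) * ∑ e ∈ U, bernoulliMean U x (fun S => discreteDeriv e F S ^ 2) := by
      rw [mul_sum, mul_sum, ← sum_add_distrib]
      refine sum_congr rfl fun e he => ?_
      have hae : a ≠ e := fun h => ha (h ▸ he)
      rw [bernoulliMean_insert ha]
      simp only [discreteDeriv_comp_insert hae, smul_eq_mul]
    rw [hsum, bernoulliMean_insert ha, bernoulliMean_insert ha]
    simp only [smul_eq_mul]
    set A := bernoulliMean U x fun S => F (insert a S)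
    set B := bernoulliMean U x F
    have : (x * A + (1 - x) * B) ^ 2 = x * A ^ 2 + (1 - x) * B ^ 2 - x * (1 - x) * (A - B) ^ 2 := by
      ring
    rw [this]
    linarith

/-- The mean of a supermodular function is convex in the inclusion probability. -/
theorem bernoulliMean_sub_le_of_supermodular {x t : ℝ} (ht0 : 0 ≤ t) (htx : t ≤ x) (hx1 : x ≤ 1)
    (U : Finset α) (F : Finset α → ℝ)
    (hF : ∀ a e S, a ≠ e → discreteDeriv e F S ≤ discreteDeriv e F (insert a S)) :
    bernoulliMean U x F - bernoulliMean U t F ≤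
      (x - t) * ∑ e ∈ U, bernoulliMean U x (discreteDeriv e F) := by
  have hx0 := ht0.trans htx
  induction U using Finset.induction_on generalizing F with
  | empty => simp [bernoulliMean_empty]
  | insert a U ha ih =>
    have hF' : ∀ b e S, b ≠ e → discreteDeriv e (fun T => F (insert a T)) S ≤
        discreteDeriv e (fun T => F (insert a T)) (insert b S) := by
      intro b e S hbe
      by_cases hae : a = e
      · subst hae
        -- Once `a` is forced in, the derivative in direction `a` is zero on both sides.
        have hins : ∀ T : Finset α, insert a (T.erase a) = insert a T := fun T => by
          ext; simp only [mem_insert, mem_erase]; tauto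
        simp [discreteDeriv, hins]
      · rw [discreteDeriv_comp_insert hae, discreteDeriv_comp_insert hae, insert_comm]
        exact hF b e _ hbe
    have i1 := mul_le_mul_of_nonneg_left (ih _ hF') ht0
    have i0 := mul_le_mul_of_nonneg_left (ih F hF) (sub_nonneg.2 (htx.trans hx1))
    have hd : ∑ e ∈ U, bernoulliMean U x (discreteDeriv e F) ≤
        ∑ e ∈ U, bernoulliMean U x (discreteDeriv e fun T => F (insert a T)) := by
      refine sum_le_sum fun e he => bernoulliMean_mono hx0 hx1 fun S _ => ?_
      have hae : a ≠ e := fun h => ha (h ▸ he)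
      rw [discreteDeriv_comp_insert hae]
      exact hF a e S hae
    -- The induction hypotheses enter with weights `t` and `1 - t`, but the goal has `x` and `1 -
    -- x`. The discrepancy is `(x - t) ^ 2` times a difference that supermodularity makes
    -- nonnegative.
    have hd' := mul_le_mul_of_nonneg_left (sub_nonneg.2 hd)
      (mul_nonneg (sub_nonneg.2 htx) (sub_nonneg.2 htx))
    have hself := bernoulliMean_insert_discreteDeriv ha x id F
    simp only [id] at hself
    rw [bernoulliMean_sub] at hself
    have hsum : ∑ e ∈ U, bernoulliMean (insert a U) x (discreteDeriv e F) =
        x * ∑ e ∈ U, bernoulliMean U x (discreteDeriv e fun T => F (insert a T)) +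
        (1 - x) * ∑ e ∈ U, bernoulliMean U x (discreteDeriv e F) := by
      rw [mul_sum, mul_sum, ← sum_add_distrib]
      refine sum_congr rfl fun e he => ?_
      have hae : a ≠ e := fun h => ha (h ▸ he)
      rw [bernoulliMean_insert ha, smul_eq_mul, smul_eq_mul]
      congr 2
      exact bernoulliMean_congr _ fun S _ => (discreteDeriv_comp_insert hae F S).symm
    rw [sum_insert ha, hself, hsum, bernoulliMean_insert ha, bernoulliMean_insert ha]
    simp only [smul_eq_mul]
    linarith

theorem bernoulliMean_subset_indicator {U T : Finset α} (hT : T ⊆ U) (x : ℝ) :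
    bernoulliMean U x (fun S => if T ⊆ S then (1 : ℝ) else 0) = x ^ #T := by
  induction U using Finset.induction_on generalizing T with
  | empty => simp [bernoulliMean_empty, subset_empty.1 hT]
  | insert a U ha ih =>
    rw [bernoulliMean_insert ha]
    have h1 : bernoulliMean U x (fun S => if T ⊆ insert a S then (1 : ℝ) else 0) =
        x ^ #(T.erase a) := by
      rw [← ih (by rwa [← subset_insert_iff])]
      simp only [subset_insert_iff]
    rw [h1]
    by_cases haT : a ∈ T
    · have h2 : bernoulliMean U x (fun S => if T ⊆ S then (1 : ℝ) else 0) = 0 := by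
        refine (bernoulliMean_congr _ fun S hS => ?_).trans (bernoulliMean_const U x (0 : ℝ))
        exact if_neg fun h : T ⊆ S => ha (hS (h haT))
      rw [h2, ← card_erase_add_one haT, pow_succ]
      simp [mul_comm]
    · rw [erase_eq_of_notMem haT, ih ((subset_insert_iff_of_notMem haT).1 hT), ← add_smul]
      simp

theorem bernoulliMean_pow_card (U : Finset α) (x : ℝ) (c : ℂ) :
    bernoulliMean U x (fun S => c ^ #S) = (x * c + (1 - x)) ^ #U := by
  induction U using Finset.induction_on with
  | empty => simp [bernoulliMean_empty]
  | insert a U ha ih =>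
    rw [bernoulliMean_insert ha, ih, card_insert_of_notMem ha, pow_succ]
    have : bernoulliMean U x (fun S => c ^ #(insert a S)) = c * (x * c + (1 - x)) ^ #U := by
      rw [← ih]
      simp only [bernoulliMean, mul_sum]
      refine sum_congr rfl fun S hS => ?_
      rw [card_insert_of_notMem fun h => ha (mem_powerset.1 hS h), pow_succ, mul_smul_comm,
        mul_comm (c ^ _)]
    rw [this]
    simp only [Complex.real_smul]
    push_cast
    ring

end Finset

/-! ### Betti numbers as nullity minus rank. -/

theorem Submodule.finrank_inf_ker_add_finrank_map {K M N : Type*} [Field K] [AddCommGroup M]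
    [Module K M] [AddCommGroup N] [Module K N] [FiniteDimensional K M] (p : Submodule K M)
    (f : M →ₗ[K] N) :
    Module.finrank K (p ⊓ LinearMap.ker f : Submodule K M) + Module.finrank K (p.map f) =
      Module.finrank K p := by
  have h := (f.domRestrict p).finrank_range_add_finrank_ker
  have h1 : LinearMap.range (f.domRestrict p) = p.map f := by
    rw [LinearMap.domRestrict, LinearMap.range_comp, Submodule.range_subtype]
  have h2 : Module.finrank K (LinearMap.ker (f.domRestrict p)) =
      Module.finrank K (p ⊓ LinearMap.ker f : Submodule K M) := by
    have h3 : (LinearMap.ker (f.domRestrict p)).map p.subtype = p ⊓ LinearMap.ker f := by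
      rw [LinearMap.domRestrict, LinearMap.ker_comp, Submodule.map_comap_subtype]
    rw [← h3]
    exact (Submodule.equivMapOfInjective _ p.injective_subtype _).finrank_eq
  rw [h1, h2] at h
  rw [← h, add_comm]

theorem Finsupp.finrank_supported {α : Type*} [Finite α] (s : Set α) :
    Module.finrank ℚ (Finsupp.supported ℚ ℚ s) = s.ncard := by
  classical
  have := Fintype.ofFinite α
  rw [(Finsupp.supportedEquivFinsupp s).finrank_eq, Module.finrank_finsupp_self,
    Set.ncard_eq_toFinset_card', Set.toFinset_card]

namespace SimpleGraph

section SimplexBoundary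

variable {V : Type*} [LinearOrder V]

/-- The boundary operator on chains of arbitrary finite vertex sets. -/
noncomputable def simplexBoundary (V : Type*) [LinearOrder V] :
    (Finset V →₀ ℚ) →ₗ[ℚ] (Finset V →₀ ℚ) :=
  Finsupp.linearCombination ℚ fun s : Finset V =>
    ∑ v : s, Finsupp.single (s.erase v.1) (AbstractSimplicialComplex.vertexSign s v.1)

/-- The inclusion of the chains of a complex into the chains of all vertex sets. -/
noncomputable def chainInclusion (K : AbstractSimplicialComplex V) (k : ℕ) :
    K.Chain k →ₗ[ℚ] (Finset V →₀ ℚ) :=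
  Finsupp.lmapDomain ℚ ℚ Subtype.val

theorem chainInclusion_injective (K : AbstractSimplicialComplex V) (k : ℕ) :
    Function.Injective (chainInclusion K k) :=
  Finsupp.mapDomain_injective Subtype.val_injective

/-- Placing the chains of all complexes in one ambient space turns the cycle spaces of different
graphs into subspaces that can be intersected and added. -/
theorem simplexBoundary_comp_chainInclusion (K : AbstractSimplicialComplex V) (k : ℕ) :
    simplexBoundary V ∘ₗ chainInclusion K (k + 1) = chainInclusion K k ∘ₗ K.boundary k := by
  ext1 s
  ext1
  simp [simplexBoundary, chainInclusion, AbstractSimplicialComplex.boundary,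
    Finsupp.mapDomain_single, AbstractSimplicialComplex.Face.facet]

theorem range_chainInclusion (G : SimpleGraph V) (k : ℕ) :
    LinearMap.range (chainInclusion G.cliqueComplex k) =
      Finsupp.supported ℚ ℚ (G.cliqueSet (k + 1)) := by
  have h : G.cliqueSet (k + 1) = Set.range (Subtype.val : G.cliqueComplex.Face k → Finset V) := by
    ext s
    simp only [mem_cliqueSet_iff, isNClique_iff, Subtype.range_coe_subtype, Set.mem_ofPred_eq]
    refine ⟨fun ⟨h1, h2⟩ => ⟨⟨Finset.card_pos.1 (by omega), h1⟩, h2⟩, fun ⟨h1, h2⟩ => ⟨h1.2, h2⟩⟩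
  rw [h, chainInclusion, Finsupp.range_lmapDomain, Finsupp.supported_eq_span_single,
    ← Set.range_comp]
  rfl

end SimplexBoundary

section Rank

variable {V : Type*} [LinearOrder V] [Fintype V]

/-- The number of `k`-dimensional cliques, i.e. of cliques on `k + 1` vertices. -/
noncomputable def cliqueCount (k : ℕ) (G : SimpleGraph V) : ℕ := (G.cliqueSet (k + 1)).ncard

/-- The dimension of the space of `k`-cycles supported on cliques. -/
noncomputable def cliqueNullity (k : ℕ) (G : SimpleGraph V) : ℕ :=
  Module.finrank ℚ (Finsupp.supported ℚ ℚ (G.cliqueSet (k + 1)) ⊓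
    LinearMap.ker (simplexBoundary V) : Submodule ℚ (Finset V →₀ ℚ))

/-- The rank of the boundary operator on the `k`-chains supported on cliques. -/
noncomputable def cliqueRank (k : ℕ) (G : SimpleGraph V) : ℕ :=
  Module.finrank ℚ ((Finsupp.supported ℚ ℚ (G.cliqueSet (k + 1))).map (simplexBoundary V))

theorem cliqueNullity_add_cliqueRank (k : ℕ) (G : SimpleGraph V) :
    cliqueNullity k G + cliqueRank k G = cliqueCount k G := by
  rw [cliqueNullity, cliqueRank, Submodule.finrank_inf_ker_add_finrank_map,
    Finsupp.finrank_supported, cliqueCount]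

theorem map_supported_cliqueSet (k : ℕ) (G : SimpleGraph V) :
    (Finsupp.supported ℚ ℚ (G.cliqueSet (k + 2))).map (simplexBoundary V) =
      (G.cliqueComplex.boundaries k).map (chainInclusion G.cliqueComplex k) := by
  rw [← range_chainInclusion, ← LinearMap.range_comp, simplexBoundary_comp_chainInclusion,
    LinearMap.range_comp, AbstractSimplicialComplex.boundaries]

theorem finrank_boundaries (k : ℕ) (G : SimpleGraph V) :
    Module.finrank ℚ (G.cliqueComplex.boundaries k) = cliqueRank (k + 1) G := by
  rw [cliqueRank, map_supported_cliqueSet]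
  exact (Submodule.equivMapOfInjective _ (chainInclusion_injective _ _) _).finrank_eq

/-- Degree 0 is excluded: `simplexBoundary` sends a vertex to the empty set, whereas every 0-chain
counts as a cycle in unreduced homology. -/
theorem finrank_cycles (k : ℕ) (G : SimpleGraph V) :
    Module.finrank ℚ (G.cliqueComplex.cycles (k + 1)) = cliqueNullity (k + 1) G := by
  have h : (G.cliqueComplex.cycles (k + 1)).map (chainInclusion G.cliqueComplex (k + 1)) =
      Finsupp.supported ℚ ℚ (G.cliqueSet (k + 2)) ⊓ LinearMap.ker (simplexBoundary V) := by
    rw [← range_chainInclusion, ← Submodule.map_comap_eq, ← LinearMap.ker_comp,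
      simplexBoundary_comp_chainInclusion, LinearMap.ker_comp_of_ker_eq_bot _
      (LinearMap.ker_eq_bot.2 (chainInclusion_injective _ _)), AbstractSimplicialComplex.cycles]
  rw [cliqueNullity, ← h]
  exact (Submodule.equivMapOfInjective _ (chainInclusion_injective _ _) _).finrank_eq

theorem betti_cliqueComplex (k : ℕ) (G : SimpleGraph V) :
    G.cliqueComplex.betti (k + 1) + cliqueRank (k + 2) G = cliqueNullity (k + 1) G := by
  have hle := G.cliqueComplex.boundaries_le_cycles (k + 1)
  have h := Submodule.finrank_quotient_add_finrank
    ((G.cliqueComplex.boundaries (k + 1)).submoduleOf (G.cliqueComplex.cycles (k + 1)))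
  rw [(Submodule.submoduleOfEquivOfLe hle).finrank_eq, finrank_boundaries, finrank_cycles] at h
  exact h

theorem cliqueRank_succ_le (k : ℕ) (G : SimpleGraph V) :
    cliqueRank (k + 1) G ≤ cliqueCount k G := by
  rw [cliqueRank, map_supported_cliqueSet, cliqueCount, ← Finsupp.finrank_supported,
    ← range_chainInclusion]
  exact Submodule.finrank_mono LinearMap.map_le_range

theorem cliqueNullity_mono (k : ℕ) {G H : SimpleGraph V} (h : G ≤ H) :
    cliqueNullity k G ≤ cliqueNullity k H :=
  Submodule.finrank_mono (inf_le_inf_right _ (Finsupp.supported_mono (cliqueSet_mono h)))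

theorem cliqueRank_mono (k : ℕ) {G H : SimpleGraph V} (h : G ≤ H) :
    cliqueRank k G ≤ cliqueRank k H :=
  Submodule.finrank_mono (Submodule.map_mono (Finsupp.supported_mono (cliqueSet_mono h)))

/-- The cycle spaces of `G` and `H` meet in that of `G ⊓ H`, while their sum lies in that of `G ⊔
H`. The dimension formula for sums and intersections gives the inequality. -/
theorem cliqueNullity_supermodular (k : ℕ) (G H : SimpleGraph V) :
    cliqueNullity k G + cliqueNullity k H ≤ cliqueNullity k (G ⊔ H) + cliqueNullity k (G ⊓ H) := by
  have hinf : (G ⊓ H).cliqueSet (k + 1) = G.cliqueSet (k + 1) ∩ H.cliqueSet (k + 1) := by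
    ext s
    simp only [mem_cliqueSet_iff, isNClique_iff, Set.mem_inter_iff, IsClique, Set.Pairwise, inf_adj]
    grind
  unfold cliqueNullity
  rw [← Submodule.finrank_sup_add_finrank_inf_eq, hinf, Finsupp.supported_inter,
    ← inf_inf_distrib_right]
  refine Nat.add_le_add_right (Submodule.finrank_mono (sup_le ?_ ?_)) _
  · exact inf_le_inf_right _ (Finsupp.supported_mono (cliqueSet_mono le_sup_left))
  · exact inf_le_inf_right _ (Finsupp.supported_mono (cliqueSet_mono le_sup_right))

end Rank

end SimpleGraph

/-! ### Counting vertex sets through an edge, and their overlaps. -/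

namespace Finset

variable {V : Type*} [DecidableEq V]

/-- The unordered pairs of distinct elements of a finite set. -/
def edges (A : Finset V) : Finset (Sym2 V) := {e ∈ A.sym2 | ¬e.IsDiag}

theorem mem_edges {A : Finset V} {e : Sym2 V} : e ∈ A.edges ↔ (∀ v ∈ e, v ∈ A) ∧ ¬e.IsDiag := by
  simp [edges, mem_sym2_iff]

theorem card_edges (A : Finset V) : #A.edges = (#A).choose 2 := by
  rw [← Sym2.card_image_offDiag]
  congr 1
  ext e
  induction e with
  | h a b => simp [mem_edges, Sym2.mk]; grind

theorem edges_inter (A B : Finset V) : (A ∩ B).edges = A.edges ∩ B.edges := by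
  ext e
  simp only [mem_edges, mem_inter]
  grind

theorem edges_mono {A B : Finset V} (h : A ⊆ B) : A.edges ⊆ B.edges := fun e he => by
  rw [mem_edges] at he ⊢
  exact ⟨fun v hv => h (he.1 v hv), he.2⟩

theorem card_union_erase_edges {A B : Finset V} {i : ℕ} (hA : #A = i) (hB : #B = i) {e : Sym2 V}
    (heA : e ∈ A.edges) :
    #(A.edges.erase e ∪ B.edges.erase e) = 2 * i.choose 2 - 1 - (#(A ∩ B)).choose 2 := by
  have h := card_union_add_card_inter A.edges B.edges
  rw [← edges_inter, card_edges, card_edges, card_edges, hA, hB] at h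
  rw [← erase_union_distrib, card_erase_of_mem (mem_union_left _ heA)]
  omega

theorem two_le_card_inter {A B : Finset V} {e : Sym2 V} (heA : e ∈ A.edges) (heB : e ∈ B.edges) :
    2 ≤ #(A ∩ B) := by
  have h : e ∈ (A ∩ B).edges := by rw [edges_inter]; exact mem_inter.2 ⟨heA, heB⟩
  by_contra hlt
  have := card_pos.2 ⟨e, h⟩
  rw [card_edges, Nat.choose_eq_zero_of_lt (by omega)] at this
  omega

variable [Fintype V]

/-- The `i`-element vertex sets that contain both ends of `e`. -/
def supersets (i : ℕ) (e : Sym2 V) : Finset (Finset V) := {A ∈ powersetCard i univ | e ∈ A.edges}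

theorem mem_supersets {i : ℕ} {e : Sym2 V} {A : Finset V} :
    A ∈ supersets i e ↔ #A = i ∧ e ∈ A.edges := by
  simp [supersets, mem_powersetCard]

theorem card_supersets (i : ℕ) {e : Sym2 V} (he : ¬e.IsDiag) :
    #(supersets (i + 2) e) = (Fintype.card V - 2).choose i := by
  induction e with
  | h a b =>
    have hab : a ≠ b := by simpa using he
    have hc : #((univ : Finset V) \ {a, b}) = Fintype.card V - 2 := by
      rw [card_sdiff_of_subset (subset_univ _), card_pair hab, card_univ]
    rw [← hc, ← card_powersetCard]
    refine card_bij' (fun A _ => A \ {a, b}) (fun B _ => B ∪ {a, b}) ?_ ?_ ?_ ?_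
    · intro A hA
      obtain ⟨h1, h2⟩ := mem_supersets.1 hA
      have hs : {a, b} ⊆ A := by
        have := (mem_edges.1 h2).1
        intro v hv
        exact this v (by simpa using hv)
      rw [mem_powersetCard, card_sdiff_of_subset hs, card_pair hab]
      exact ⟨sdiff_subset_sdiff (subset_univ _) le_rfl, by omega⟩
    · intro B hB
      obtain ⟨h1, h2⟩ := mem_powersetCard.1 hB
      have hd : Disjoint B {a, b} := disjoint_of_subset_left h1 sdiff_disjoint
      rw [mem_supersets, card_union_of_disjoint hd, card_pair hab, mem_edges]
      refine ⟨by omega, fun v hv => mem_union_right _ (by simpa using hv), he⟩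
    · intro A hA
      obtain ⟨h1, h2⟩ := mem_supersets.1 hA
      refine sdiff_union_of_subset fun v hv => (mem_edges.1 h2).1 v (by simpa using hv)
    · intro B hB
      obtain ⟨h1, h2⟩ := mem_powersetCard.1 hB
      exact union_sdiff_cancel_right (disjoint_of_subset_left h1 sdiff_disjoint)

theorem card_filter_card_inter_le {i l : ℕ} {A : Finset V} (hA : #A = i) :
    #{B ∈ powersetCard i (univ : Finset V) | #(A ∩ B) = l} ≤
      2 ^ i * Fintype.card V ^ (i - l) := by
  calc #{B ∈ powersetCard i (univ : Finset V) | #(A ∩ B) = l}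
      ≤ #(A.powerset ×ˢ powersetCard (i - l) (univ : Finset V)) := by
        refine card_le_card_of_injOn (fun B => (A ∩ B, B \ A)) ?_ ?_
        · intro B hB
          obtain ⟨h1, h2⟩ := mem_filter.1 (mem_coe.1 hB)
          have h1' := (mem_powersetCard.1 h1).2
          refine mem_coe.2 (mem_product.2 ⟨mem_powerset.2 inter_subset_left,
            mem_powersetCard.2 ⟨subset_univ _, ?_⟩⟩)
          have := card_sdiff_add_card_inter B A
          rw [inter_comm] at this
          simp only
          omega
        · intro B _ C _ h
          simp only [Prod.mk.injEq] at h
          rw [← sdiff_union_inter B A, ← sdiff_union_inter C A, h.2, inter_comm B, inter_comm C, h.1]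
    _ ≤ 2 ^ i * Fintype.card V ^ (i - l) := by
        rw [card_product, card_powerset, hA, card_powersetCard, card_univ]
        exact Nat.mul_le_mul_left _ (Nat.choose_le_pow _ _)

theorem card_supersets_pairs_le (i l : ℕ) {e : Sym2 V} (he : ¬e.IsDiag) (hl : l ≤ i) :
    #{q ∈ supersets (i + 2) e ×ˢ supersets (i + 2) e | #(q.1 ∩ q.2) = l + 2} ≤
      2 ^ (i + 2) * Fintype.card V ^ (2 * i - l) := by
  have h1 : #(supersets (i + 2) e) ≤ Fintype.card V ^ i := by
    rw [card_supersets i he]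
    exact (Nat.choose_le_pow _ _).trans (Nat.pow_le_pow_left (Nat.sub_le _ _) _)
  calc #{q ∈ supersets (i + 2) e ×ˢ supersets (i + 2) e | #(q.1 ∩ q.2) = l + 2}
      = ∑ A ∈ supersets (i + 2) e, #{B ∈ supersets (i + 2) e | #(A ∩ B) = l + 2} := by
        simp only [card_filter, sum_product]
    _ ≤ ∑ A ∈ supersets (i + 2) e, 2 ^ (i + 2) * Fintype.card V ^ (i - l) := by
        refine sum_le_sum fun A hA => ?_
        refine le_trans (card_le_card ?_) ((card_filter_card_inter_le (l := l + 2)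
          (mem_supersets.1 hA).1).trans_eq ?_)
        · exact filter_subset_filter _ (filter_subset _ _)
        · rw [Nat.add_sub_add_right]
    _ ≤ Fintype.card V ^ i * (2 ^ (i + 2) * Fintype.card V ^ (i - l)) := by
        rw [sum_const, smul_eq_mul]
        exact Nat.mul_le_mul_right _ h1
    _ = 2 ^ (i + 2) * Fintype.card V ^ (2 * i - l) := by
        rw [show 2 * i - l = i + (i - l) by omega, pow_add]
        ring

end Finset

/-! ### Moments of clique counts and of their derivatives. -/

namespace SimpleGraph

open Finset

variable {V : Type*} [LinearOrder V] [Fintype V]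

/-- The graph with the given finite set of edges. -/
abbrev ofEdges (S : Finset (Sym2 V)) : SimpleGraph V := fromEdgeSet (S : Set (Sym2 V))

/-- The edges of the complete graph. -/
abbrev allEdges (V : Type*) [DecidableEq V] [Fintype V] : Finset (Sym2 V) := (univ : Finset V).edges

theorem mem_cliqueSet_ofEdges {S : Finset (Sym2 V)} {i : ℕ} {A : Finset V} :
    A ∈ (ofEdges S).cliqueSet i ↔ A ∈ powersetCard i univ ∧ A.edges ⊆ S := by
  rw [mem_cliqueSet_iff, isNClique_iff, mem_powersetCard, and_comm]
  refine and_congr (by simp) ?_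
  constructor
  · intro h e he
    induction e with
    | h a b =>
      obtain ⟨h1, h2⟩ := mem_edges.1 he
      have hab : a ≠ b := by simpa using h2
      exact mem_coe.1 (((fromEdgeSet_adj _).1 (h (h1 a (by simp)) (h1 b (by simp)) hab)).1)
  · intro h a ha b hb hab
    refine (fromEdgeSet_adj _).2 ⟨mem_coe.2 (h (mem_edges.2 ⟨?_, by simpa using hab⟩)), hab⟩
    intro v hv
    rcases Sym2.mem_iff.1 hv with rfl | rfl
    exacts [ha, hb]

theorem cliqueCount_ofEdges (k : ℕ) (S : Finset (Sym2 V)) :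
    (cliqueCount k (ofEdges S) : ℝ) =
      ∑ A ∈ powersetCard (k + 1) (univ : Finset V), if A.edges ⊆ S then (1 : ℝ) else 0 := by
  have h : (ofEdges S).cliqueSet (k + 1) =
      ({A ∈ powersetCard (k + 1) (univ : Finset V) | A.edges ⊆ S} : Finset (Finset V)) := by
    ext A
    rw [mem_cliqueSet_ofEdges, mem_coe, mem_filter]
  rw [cliqueCount, h, Set.ncard_coe_finset, card_filter]
  push_cast
  rfl

theorem bernoulliMean_cliqueCount (k : ℕ) (x : ℝ) :
    bernoulliMean (allEdges V) x (fun S => (cliqueCount k (ofEdges S) : ℝ)) =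
      (Fintype.card V).choose (k + 1) * x ^ (k + 1).choose 2 := by
  simp only [cliqueCount_ofEdges]
  rw [bernoulliMean_sum]
  have : ∀ A ∈ powersetCard (k + 1) (univ : Finset V),
      bernoulliMean (allEdges V) x (fun S => if A.edges ⊆ S then (1 : ℝ) else 0) =
        x ^ (k + 1).choose 2 := fun A hA => by
    rw [bernoulliMean_subset_indicator (edges_mono (subset_univ A)), card_edges,
      (mem_powersetCard.1 hA).2]
  rw [sum_congr rfl this, sum_const, card_powersetCard, card_univ, nsmul_eq_mul]

/-- Toggling `e` affects exactly the vertex sets containing both ends of `e` whose other edges are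
all present. -/
theorem discreteDeriv_cliqueCount (k : ℕ) (e : Sym2 V) (S : Finset (Sym2 V)) :
    discreteDeriv e (fun S => (cliqueCount k (ofEdges S) : ℝ)) S =
      ∑ A ∈ supersets (k + 1) e, if A.edges.erase e ⊆ S then (1 : ℝ) else 0 := by
  rw [discreteDeriv, cliqueCount_ofEdges, cliqueCount_ofEdges, ← sum_sub_distrib, supersets,
    sum_filter]
  refine sum_congr rfl fun A _ => ?_
  by_cases he : e ∈ A.edges
  · have h : ¬A.edges ⊆ S.erase e := fun h => notMem_erase e S (h he)
    simp [he, h, subset_insert_iff]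
  · have h1 : A.edges ⊆ insert e S ↔ A.edges ⊆ S := subset_insert_iff_of_notMem he
    have h2 : A.edges ⊆ S.erase e ↔ A.edges ⊆ S := by
      rw [subset_erase]; exact and_iff_left he
    simp [he, h1, h2]

theorem bernoulliMean_discreteDeriv_cliqueCount (i : ℕ) (x : ℝ) {e : Sym2 V} (he : ¬e.IsDiag) :
    bernoulliMean (allEdges V) x
        (discreteDeriv e fun S => (cliqueCount (i + 1) (ofEdges S) : ℝ)) =
      (Fintype.card V - 2).choose i * x ^ ((i + 2).choose 2 - 1) := by
  rw [bernoulliMean_congr x fun S _ => discreteDeriv_cliqueCount (i + 1) e S, bernoulliMean_sum]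
  have : ∀ A ∈ supersets (i + 1 + 1) e, bernoulliMean (allEdges V) x
      (fun S => if A.edges.erase e ⊆ S then (1 : ℝ) else 0) = x ^ ((i + 2).choose 2 - 1) := by
    intro A hA
    obtain ⟨h1, h2⟩ := mem_supersets.1 hA
    rw [bernoulliMean_subset_indicator ((erase_subset _ _).trans (edges_mono (subset_univ A))),
      card_erase_of_mem h2, card_edges, h1]
  rw [sum_congr rfl this, sum_const, card_supersets i he, nsmul_eq_mul]

theorem bernoulliMean_sq_discreteDeriv_cliqueCount (i : ℕ) (x : ℝ) (e : Sym2 V) :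
    bernoulliMean (allEdges V) x
        (fun S => discreteDeriv e (fun S => (cliqueCount (i + 1) (ofEdges S) : ℝ)) S ^ 2) =
      ∑ q ∈ supersets (i + 2) e ×ˢ supersets (i + 2) e,
        x ^ (2 * (i + 2).choose 2 - 1 - (#(q.1 ∩ q.2)).choose 2) := by
  simp only [discreteDeriv_cliqueCount]
  have h : ∀ S : Finset (Sym2 V),
      (∑ A ∈ supersets (i + 1 + 1) e, if A.edges.erase e ⊆ S then (1 : ℝ) else 0) ^ 2 =
      ∑ q ∈ supersets (i + 2) e ×ˢ supersets (i + 2) e,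
        if q.1.edges.erase e ∪ q.2.edges.erase e ⊆ S then (1 : ℝ) else 0 := by
    intro S
    rw [sq, sum_mul_sum, sum_product]
    refine sum_congr rfl fun A _ => sum_congr rfl fun B _ => ?_
    simp only [union_subset_iff, ite_and, mul_ite, mul_one, mul_zero]
    split_ifs <;> rfl
  simp only [h]
  rw [bernoulliMean_sum]
  refine sum_congr rfl fun q hq => ?_
  obtain ⟨hA, hB⟩ := mem_product.1 hq
  obtain ⟨hA1, hA2⟩ := mem_supersets.1 hA
  obtain ⟨hB1, hB2⟩ := mem_supersets.1 hB
  rw [bernoulliMean_subset_indicator (union_subset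
    ((erase_subset _ _).trans (edges_mono (subset_univ _)))
    ((erase_subset _ _).trans (edges_mono (subset_univ _)))), card_union_erase_edges hA1 hB1 hA2]

/-- Pairs are grouped by the number `l` of common vertices besides the ends of `e`. The set `I`
allows both the full second moment and the variance, where `l = 0` is left out. -/
theorem sum_supersets_pairs_le (i : ℕ) {x : ℝ} (hx : 0 ≤ x) {e : Sym2 V} (he : ¬e.IsDiag)
    (I : Finset ℕ) (hI : ∀ l ∈ I, l ≤ i) :
    ∑ q ∈ supersets (i + 2) e ×ˢ supersets (i + 2) e with #(q.1 ∩ q.2) - 2 ∈ I,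
        x ^ (2 * (i + 2).choose 2 - 1 - (#(q.1 ∩ q.2)).choose 2) ≤
      ∑ l ∈ I, 2 ^ (i + 2) * ((Fintype.card V : ℝ) ^ (2 * i - l) *
        x ^ (2 * (i + 2).choose 2 - 1 - (l + 2).choose 2)) := by
  have hmaps : ∀ q ∈ ({q ∈ supersets (i + 2) e ×ˢ supersets (i + 2) e |
      #(q.1 ∩ q.2) - 2 ∈ I} : Finset _), #(q.1 ∩ q.2) - 2 ∈ I := fun q hq => (mem_filter.1 hq).2
  rw [← sum_fiberwise_of_maps_to hmaps]
  refine sum_le_sum fun l hl => ?_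
  have hfil : ∀ q ∈ ({q ∈ ({q ∈ supersets (i + 2) e ×ˢ supersets (i + 2) e |
      #(q.1 ∩ q.2) - 2 ∈ I} : Finset _) | #(q.1 ∩ q.2) - 2 = l} : Finset _),
      q ∈ supersets (i + 2) e ×ˢ supersets (i + 2) e ∧ #(q.1 ∩ q.2) = l + 2 := by
    intro q hq
    obtain ⟨h1, h2⟩ := mem_filter.1 hq
    have h3 := (mem_filter.1 h1).1
    obtain ⟨hA, hB⟩ := mem_product.1 h3
    have := two_le_card_inter (mem_supersets.1 hA).2 (mem_supersets.1 hB).2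
    exact ⟨h3, by omega⟩
  rw [sum_congr rfl fun q hq => by rw [(hfil q hq).2], sum_const, nsmul_eq_mul, ← mul_assoc]
  refine mul_le_mul_of_nonneg_right ?_ (pow_nonneg hx _)
  refine le_trans (Nat.cast_le.2 ((card_le_card fun q hq => mem_filter.2 (hfil q hq)).trans
    (card_supersets_pairs_le i l he (hI l hl)))) ?_
  push_cast
  rfl

theorem card_inter_sub_two_le {i : ℕ} {e : Sym2 V} {q : Finset V × Finset V}
    (hq : q ∈ supersets (i + 2) e ×ˢ supersets (i + 2) e) : #(q.1 ∩ q.2) - 2 ≤ i := by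
  have h1 := (mem_supersets.1 (mem_product.1 hq).1).1
  have h2 := card_le_card (inter_subset_left (s₁ := q.1) (s₂ := q.2))
  omega

theorem bernoulliMean_sq_discreteDeriv_cliqueCount_le (i : ℕ) {x : ℝ} (hx : 0 ≤ x) {e : Sym2 V}
    (he : ¬e.IsDiag) :
    bernoulliMean (allEdges V) x
        (fun S => discreteDeriv e (fun S => (cliqueCount (i + 1) (ofEdges S) : ℝ)) S ^ 2) ≤
      ∑ l ∈ range (i + 1), 2 ^ (i + 2) * ((Fintype.card V : ℝ) ^ (2 * i - l) *
        x ^ (2 * (i + 2).choose 2 - 1 - (l + 2).choose 2)) := by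
  rw [bernoulliMean_sq_discreteDeriv_cliqueCount]
  refine le_trans (le_of_eq ?_) (sum_supersets_pairs_le i hx he (range (i + 1))
    fun l hl => Nat.lt_succ_iff.1 (mem_range.1 hl))
  rw [filter_true_of_mem]
  exact fun q hq => mem_range.2 (Nat.lt_succ_iff.2 (card_inter_sub_two_le hq))

/-- Two sets sharing only the ends of `e` have disjoint remaining edges, so such pairs contribute at
most the squared mean and cancel against it. -/
theorem variance_discreteDeriv_cliqueCount_le (i : ℕ) {x : ℝ} (hx : 0 ≤ x) {e : Sym2 V}
    (he : ¬e.IsDiag) :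
    bernoulliMean (allEdges V) x
        (fun S => (discreteDeriv e (fun S => (cliqueCount (i + 1) (ofEdges S) : ℝ)) S -
          (Fintype.card V - 2).choose i * x ^ ((i + 2).choose 2 - 1)) ^ 2) ≤
      ∑ l ∈ Icc 1 i, 2 ^ (i + 2) * ((Fintype.card V : ℝ) ^ (2 * i - l) *
        x ^ (2 * (i + 2).choose 2 - 1 - (l + 2).choose 2)) := by
  refine le_trans ?_ (sum_supersets_pairs_le i hx he (Icc 1 i) fun l hl => (mem_Icc.1 hl).2)
  have hm := bernoulliMean_discreteDeriv_cliqueCount i x he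
  set F := discreteDeriv e (fun S => (cliqueCount (i + 1) (ofEdges S) : ℝ)) with hF
  set m : ℝ := (Fintype.card V - 2).choose i * x ^ ((i + 2).choose 2 - 1) with hmdef
  have hexp : (fun S => (F S - m) ^ 2) = fun S => (F S ^ 2 - 2 * m * F S) + m ^ 2 := by
    ext S; ring
  rw [hexp, bernoulliMean_add, bernoulliMean_sub, bernoulliMean_mul_left, bernoulliMean_const, hm,
    hF, bernoulliMean_sq_discreteDeriv_cliqueCount]
  rw [← sum_filter_add_sum_filter_not (supersets (i + 2) e ×ˢ supersets (i + 2) e)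
    (fun q => #(q.1 ∩ q.2) - 2 ∈ Icc 1 i)]
  have hc2 : 1 ≤ (i + 2).choose 2 := Nat.choose_pos (by omega)
  have hrest : ∑ q ∈ supersets (i + 2) e ×ˢ supersets (i + 2) e with
      ¬#(q.1 ∩ q.2) - 2 ∈ Icc 1 i,
        x ^ (2 * (i + 2).choose 2 - 1 - (#(q.1 ∩ q.2)).choose 2) ≤ m ^ 2 := by
    have hval : ∀ q ∈ ({q ∈ supersets (i + 2) e ×ˢ supersets (i + 2) e |
        ¬#(q.1 ∩ q.2) - 2 ∈ Icc 1 i} : Finset _),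
        x ^ (2 * (i + 2).choose 2 - 1 - (#(q.1 ∩ q.2)).choose 2) =
          (x ^ ((i + 2).choose 2 - 1)) ^ 2 := by
      intro q hq
      obtain ⟨h1, h2⟩ := mem_filter.1 hq
      have h3 := card_inter_sub_two_le h1
      have h4 := two_le_card_inter (mem_supersets.1 (mem_product.1 h1).1).2
        (mem_supersets.1 (mem_product.1 h1).2).2
      rw [mem_Icc] at h2
      have h5 : #(q.1 ∩ q.2) = 2 := by omega
      rw [h5, ← pow_mul, Nat.choose_self]
      congr 1
      omega
    rw [sum_congr rfl hval, sum_const, nsmul_eq_mul, hmdef, mul_pow]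
    refine mul_le_mul_of_nonneg_right ?_ (by positivity)
    have := card_filter_le (supersets (i + 2) e ×ˢ supersets (i + 2) e)
      (fun q => ¬#(q.1 ∩ q.2) - 2 ∈ Icc 1 i)
    rw [card_product, card_supersets i he, ← sq] at this
    exact_mod_cast this
  linarith

end SimpleGraph

/-! ### The effect of one edge on nullities and ranks. -/

namespace SimpleGraph

open Finset

variable {V : Type*} [LinearOrder V] [Fintype V]

theorem ofEdges_mono {S T : Finset (Sym2 V)} (h : S ⊆ T) : ofEdges S ≤ ofEdges T :=
  fromEdgeSet_mono (coe_subset.2 h)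

theorem ofEdges_erase_le_insert (S : Finset (Sym2 V)) (e : Sym2 V) :
    ofEdges (S.erase e) ≤ ofEdges (insert e S) :=
  ofEdges_mono ((erase_subset _ _).trans (subset_insert _ _))

theorem discreteDeriv_cliqueNullity_le_insert (k : ℕ) (a e : Sym2 V) (S : Finset (Sym2 V)) :
    discreteDeriv e (fun S => (cliqueNullity k (ofEdges S) : ℝ)) S ≤
      discreteDeriv e (fun S => (cliqueNullity k (ofEdges S) : ℝ)) (insert a S) := by
  have h := cliqueNullity_supermodular k (ofEdges (insert e S)) (ofEdges ((insert a S).erase e))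
  rw [← fromEdgeSet_union, ← fromEdgeSet_inter, ← coe_union, ← coe_inter] at h
  have h1 : insert e S ∪ (insert a S).erase e = insert e (insert a S) := by
    ext; simp only [mem_union, mem_insert, mem_erase]; tauto
  have h2 : insert e S ∩ (insert a S).erase e = S.erase e := by
    ext; simp only [mem_inter, mem_insert, mem_erase]; grind
  rw [h1, h2] at h
  have h' : (cliqueNullity k (ofEdges (insert e S)) : ℝ) +
      cliqueNullity k (ofEdges ((insert a S).erase e)) ≤
      cliqueNullity k (ofEdges (insert e (insert a S))) + cliqueNullity k (ofEdges (S.erase e)) := by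
    exact_mod_cast h
  simp only [discreteDeriv]
  linarith

theorem discreteDeriv_cliqueNullity_nonneg (k : ℕ) (e : Sym2 V) (S : Finset (Sym2 V)) :
    0 ≤ discreteDeriv e (fun S => (cliqueNullity k (ofEdges S) : ℝ)) S :=
  sub_nonneg.2 (Nat.cast_le.2 (cliqueNullity_mono k (ofEdges_erase_le_insert S e)))

theorem discreteDeriv_cliqueRank_nonneg (k : ℕ) (e : Sym2 V) (S : Finset (Sym2 V)) :
    0 ≤ discreteDeriv e (fun S => (cliqueRank k (ofEdges S) : ℝ)) S :=
  sub_nonneg.2 (Nat.cast_le.2 (cliqueRank_mono k (ofEdges_erase_le_insert S e)))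

theorem discreteDeriv_cliqueNullity_add_cliqueRank (k : ℕ) (e : Sym2 V) (S : Finset (Sym2 V)) :
    discreteDeriv e (fun S => (cliqueNullity k (ofEdges S) : ℝ)) S +
      discreteDeriv e (fun S => (cliqueRank k (ofEdges S) : ℝ)) S =
      discreteDeriv e (fun S => (cliqueCount k (ofEdges S) : ℝ)) S := by
  simp only [discreteDeriv, ← cliqueNullity_add_cliqueRank]
  push_cast
  ring

/-- From (1 - δ)(1 + δ) ≤ 1 and Bernoulli's inequality, (1 - δ)^K ≤ 1/(1 + Kδ); then use y/(1 + y) ≥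
y(1 - y). -/
theorem one_sub_one_sub_pow_ge (K : ℕ) {δ : ℝ} (h0 : 0 ≤ δ) (h1 : δ ≤ 1) :
    K * δ * (1 - K * δ) ≤ 1 - (1 - δ) ^ K := by
  have hb : 1 + K * δ ≤ (1 + δ) ^ K := one_add_mul_le_pow (by linarith) K
  have hp : (1 - δ) ^ K * (1 + δ) ^ K ≤ 1 := by
    rw [← mul_pow]
    exact pow_le_one₀ (by nlinarith) (by nlinarith)
  have hq : 0 ≤ (1 - δ) ^ K := pow_nonneg (by linarith) _
  have hK : 0 ≤ K * δ := by positivity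
  have h3 : (1 - δ) ^ K * (1 + K * δ) ≤ 1 := (mul_le_mul_of_nonneg_left hb hq).trans hp
  by_contra hlt
  push Not at hlt
  have h4 : 1 - K * δ * (1 - K * δ) < (1 - δ) ^ K := by linarith
  have h5 := mul_lt_mul_of_pos_right h4 (show 0 < 1 + K * δ by linarith)
  nlinarith [mul_nonneg hK (mul_nonneg hK hK)]

theorem card_allEdges : #(allEdges V) = (Fintype.card V).choose 2 := by
  rw [card_edges, card_univ]

theorem not_isDiag_of_mem_allEdges {e : Sym2 V} (he : e ∈ allEdges V) : ¬e.IsDiag :=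
  (mem_edges.1 he).2

/-- The expected number of `(i + 1)`-dimensional cliques created by adding a fixed edge to the
binomial random graph on `n` vertices with edge probability `x`. -/
noncomputable def meanInfluence (n i : ℕ) (x : ℝ) : ℝ :=
  (n - 2).choose i * x ^ ((i + 2).choose 2 - 1)

theorem meanInfluence_nonneg (n i : ℕ) {x : ℝ} (hx : 0 ≤ x) : 0 ≤ meanInfluence n i x := by
  unfold meanInfluence; positivity

/-- Double counting of pairs consisting of a clique and one of its edges. -/
theorem choose_two_mul_meanInfluence (n i : ℕ) (x : ℝ) :
    n.choose 2 * meanInfluence n i x * x =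
      (i + 2).choose 2 * (n.choose (i + 2) * x ^ (i + 2).choose 2) := by
  have h : n.choose (i + 2) * (i + 2).choose 2 = n.choose 2 * (n - 2).choose i := by
    simpa using Nat.choose_mul (n := n) (k := i + 2) (s := 2) (by omega)
  have h' : (n.choose (i + 2) : ℝ) * (i + 2).choose 2 = n.choose 2 * (n - 2).choose i := by
    exact_mod_cast h
  have hK : (i + 2).choose 2 = ((i + 2).choose 2 - 1) + 1 := by
    have : 1 ≤ (i + 2).choose 2 := Nat.choose_pos (by omega)
    omega
  have hp : x ^ (i + 2).choose 2 = x ^ ((i + 2).choose 2 - 1) * x := by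
    rw [← pow_succ, ← hK]
  unfold meanInfluence
  rw [hp]
  linear_combination (-(x ^ ((i + 2).choose 2 - 1) * x)) * h'

theorem two_mul_choose_two (a : ℕ) : 2 * (a + 2).choose 2 = (a + 2) * (a + 1) := by
  rw [Nat.choose_two_right, Nat.mul_div_cancel' (Nat.even_mul_pred_self (a + 2)).two_dvd]
  simp

theorem mean_cliqueCount_le {n i : ℕ} (hn : 2 * (i + 2) ≤ n) {x : ℝ} (hx : 0 < x) :
    n.choose (i + 1) * x ^ (i + 1).choose 2 ≤
      4 * (n.choose 2 * meanInfluence n i x * x) / (n * x ^ (i + 1)) := by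
  have hn0 : (0 : ℝ) < n := by exact_mod_cast (by omega : 0 < n)
  rw [le_div_iff₀ (by positivity), choose_two_mul_meanInfluence]
  have h1 : n.choose (i + 2) * (i + 2) = n.choose (i + 1) * (n - (i + 1)) :=
    Nat.choose_succ_right_eq n (i + 1)
  have h2 : (i + 2).choose 2 = (i + 1).choose 2 + (i + 1) := by
    rw [Nat.choose_succ_succ' (i + 1) 1, Nat.choose_one_right]; ring
  have h3 := two_mul_choose_two i
  -- One factor 2 comes from `n ≤ 2 * (n - (i + 1))`, the other from `(i + 2) * (i + 1) = 2 * (i +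
  -- 2).choose 2`.
  have h4 : n.choose (i + 1) * n ≤ 4 * ((i + 2).choose 2 * n.choose (i + 2)) := by
    calc n.choose (i + 1) * n ≤ n.choose (i + 1) * (2 * (n - (i + 1))) :=
          Nat.mul_le_mul_left _ (by omega)
      _ = 2 * (n.choose (i + 2) * (i + 2)) := by rw [h1]; ring
      _ ≤ 2 * (n.choose (i + 2) * (i + 2)) * (i + 1) := Nat.le_mul_of_pos_right _ (by omega)
      _ = 2 * (n.choose (i + 2) * (2 * (i + 2).choose 2)) := by rw [h3]; ring
      _ = _ := by ring
  have h4' : (n.choose (i + 1) : ℝ) * n ≤ 4 * ((i + 2).choose 2 * n.choose (i + 2)) := by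
    exact_mod_cast h4
  have h5 := mul_le_mul_of_nonneg_right h4' (by positivity : 0 ≤ x ^ ((i + 1).choose 2 + (i + 1)))
  rw [h2]
  rw [h2] at h5
  calc _ = (n.choose (i + 1) : ℝ) * n * x ^ ((i + 1).choose 2 + (i + 1)) := by rw [pow_add]; ring
    _ ≤ _ := h5
    _ = _ := by ring

/-- By convexity, the slope of the mean nullity at `x` is at least that of its secant from `(1 - δ)
* x`. Bounding the nullity below at `x` and above at `(1 - δ) * x` by clique counts makes this
secant almost as steep as the mean clique count, and the rank gets only the remainder. -/
theorem sum_mean_discreteDeriv_cliqueRank_le {i : ℕ} (hn : 2 * (i + 2) ≤ Fintype.card V) {x δ : ℝ}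
    (hx0 : 0 < x) (hx1 : x ≤ 1) (hδ0 : 0 < δ) (hδ1 : δ ≤ 1) :
    ∑ e ∈ allEdges V, bernoulliMean (allEdges V) x
        (discreteDeriv e fun S => (cliqueRank (i + 1) (ofEdges S) : ℝ)) ≤
      (Fintype.card V).choose 2 * meanInfluence (Fintype.card V) i x *
        ((i + 2).choose 2 * δ + 4 / (Fintype.card V * x ^ (i + 1) * δ)) := by
  set n := Fintype.card V with hndef
  set m := meanInfluence n i x with hm
  set K := (i + 2).choose 2 with hK
  set U := allEdges V
  have hn0 : (0 : ℝ) < n := by exact_mod_cast (by omega : 0 < n)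
  have hcount : ∑ e ∈ U, bernoulliMean U x
      (discreteDeriv e fun S => (cliqueCount (i + 1) (ofEdges S) : ℝ)) = n.choose 2 * m := by
    rw [sum_congr rfl fun e he => bernoulliMean_discreteDeriv_cliqueCount i x
      (not_isDiag_of_mem_allEdges he), sum_const, card_allEdges, nsmul_eq_mul, hm, meanInfluence]
  have hsplit : ∑ e ∈ U, bernoulliMean U x
      (discreteDeriv e fun S => (cliqueCount (i + 1) (ofEdges S) : ℝ)) =
      ∑ e ∈ U, bernoulliMean U x
        (discreteDeriv e fun S => (cliqueNullity (i + 1) (ofEdges S) : ℝ)) +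
      ∑ e ∈ U, bernoulliMean U x
        (discreteDeriv e fun S => (cliqueRank (i + 1) (ofEdges S) : ℝ)) := by
    rw [← sum_add_distrib]
    refine sum_congr rfl fun e _ => ?_
    rw [← bernoulliMean_add]
    exact bernoulliMean_congr _ fun S _ => (discreteDeriv_cliqueNullity_add_cliqueRank _ e S).symm
  have hconv := bernoulliMean_sub_le_of_supermodular (t := (1 - δ) * x) (x := x)
    (mul_nonneg (by linarith) hx0.le) (by nlinarith) hx1 U
    (fun S => (cliqueNullity (i + 1) (ofEdges S) : ℝ))
    fun a e S _ => discreteDeriv_cliqueNullity_le_insert (i + 1) a e S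
  have hlow : (n.choose (i + 2) : ℝ) * x ^ K - n.choose (i + 1) * x ^ (i + 1).choose 2 ≤
      bernoulliMean U x (fun S => (cliqueNullity (i + 1) (ofEdges S) : ℝ)) := by
    rw [← bernoulliMean_cliqueCount (V := V) (i + 1) x, ← bernoulliMean_cliqueCount (V := V) i x,
      ← bernoulliMean_sub]
    refine bernoulliMean_mono hx0.le hx1 fun S _ => ?_
    have h1 := cliqueNullity_add_cliqueRank (i + 1) (ofEdges S)
    have h2 := cliqueRank_succ_le i (ofEdges S)
    have h1' : (cliqueNullity (i + 1) (ofEdges S) : ℝ) + cliqueRank (i + 1) (ofEdges S) =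
      cliqueCount (i + 1) (ofEdges S) := by exact_mod_cast h1
    have h2' : (cliqueRank (i + 1) (ofEdges S) : ℝ) ≤ cliqueCount i (ofEdges S) := by
      exact_mod_cast h2
    linarith
  have hupp : bernoulliMean U ((1 - δ) * x) (fun S => (cliqueNullity (i + 1) (ofEdges S) : ℝ)) ≤
      n.choose (i + 2) * ((1 - δ) * x) ^ K := by
    rw [← bernoulliMean_cliqueCount (V := V) (i + 1) ((1 - δ) * x)]
    refine bernoulliMean_mono (mul_nonneg (by linarith) hx0.le) (by nlinarith) fun S _ => ?_
    have h1 := cliqueNullity_add_cliqueRank (i + 1) (ofEdges S)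
    exact_mod_cast (by omega : cliqueNullity (i + 1) (ofEdges S) ≤ cliqueCount (i + 1) (ofEdges S))
  have hF := choose_two_mul_meanInfluence n i x
  have hF1 := mean_cliqueCount_le (i := i) (n := n) hn hx0
  rw [← hm] at hF hF1
  set Z := ∑ e ∈ U, bernoulliMean U x
    (discreteDeriv e fun S => (cliqueNullity (i + 1) (ofEdges S) : ℝ))
  set R := ∑ e ∈ U, bernoulliMean U x
    (discreteDeriv e fun S => (cliqueRank (i + 1) (ofEdges S) : ℝ))
  have hbern := mul_le_mul_of_nonneg_left (one_sub_one_sub_pow_ge K hδ0.le hδ1)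
    (by positivity : 0 ≤ (n.choose (i + 2) : ℝ) * x ^ K)
  rw [mul_pow] at hupp
  set P : ℝ := n.choose 2 * m with hP
  set F : ℝ := n.choose (i + 2) * x ^ K with hFdef
  have hkey : P * x * δ * (1 - K * δ) - 4 * (P * x) / (n * x ^ (i + 1)) ≤ δ * x * Z := by
    have e1 : F * (K * δ * (1 - K * δ)) = P * x * δ * (1 - K * δ) := by rw [hF]; ring
    have e2 : (n.choose (i + 2) : ℝ) * ((1 - δ) ^ K * x ^ K) = F * (1 - δ) ^ K := by
      rw [hFdef]; ring
    rw [e1] at hbern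
    rw [e2] at hupp
    linarith
  have hw : 0 < n * x ^ (i + 1) := by positivity
  have hZ : P * (1 - K * δ) - 4 * P / (n * x ^ (i + 1) * δ) ≤ Z := by
    refine le_of_mul_le_mul_left ?_ (mul_pos hδ0 hx0)
    refine le_trans (le_of_eq ?_) hkey
    field_simp
  have : R = P - Z := by linarith
  rw [this]
  have e3 : P * (K * δ + 4 / (n * x ^ (i + 1) * δ)) =
    P - (P * (1 - K * δ) - 4 * P / (n * x ^ (i + 1) * δ)) := by ring
  rw [e3]
  linarith

end SimpleGraph

/-! ### Linearization of the Betti number in mean square. -/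

namespace SimpleGraph

open Finset

/-- Each further common vertex costs at least a factor w = n x^(i+1), since `(l + 2).choose 2 - 1 ≤
(i + 1) * l`. One of these `l` factors is kept. -/
theorem pow_mul_pow_le_div {i l n : ℕ} {x : ℝ} (hx0 : 0 < x) (hx1 : x ≤ 1)
    (hw : 1 ≤ n * x ^ (i + 1)) (hl1 : 1 ≤ l) (hli : l ≤ i) :
    (n : ℝ) ^ (2 * i - l) * x ^ (2 * (i + 2).choose 2 - 1 - (l + 2).choose 2) ≤
      (n : ℝ) ^ (2 * i) * x ^ (2 * ((i + 2).choose 2 - 1)) / (n * x ^ (i + 1)) := by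
  have hi := two_mul_choose_two i
  have hl := two_mul_choose_two l
  have hle : (l + 2).choose 2 ≤ (i + 2).choose 2 := Nat.choose_le_choose 2 (by omega)
  have hexp : 2 * ((i + 2).choose 2 - 1) ≤
      2 * (i + 2).choose 2 - 1 - (l + 2).choose 2 + (i + 1) * l := by
    have : (l + 2).choose 2 ≤ (i + 1) * l + 1 := by nlinarith
    have : 1 ≤ (l + 2).choose 2 := Nat.choose_pos (by omega)
    omega
  rw [le_div_iff₀ (by linarith)]
  calc (n : ℝ) ^ (2 * i - l) * x ^ (2 * (i + 2).choose 2 - 1 - (l + 2).choose 2) *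
        (n * x ^ (i + 1))
      ≤ (n : ℝ) ^ (2 * i - l) * x ^ (2 * (i + 2).choose 2 - 1 - (l + 2).choose 2) *
        (n * x ^ (i + 1)) ^ l := by
        gcongr
        exact le_self_pow₀ hw (by omega)
    _ = (n : ℝ) ^ (2 * i - l + l) *
        x ^ (2 * (i + 2).choose 2 - 1 - (l + 2).choose 2 + (i + 1) * l) := by
        rw [mul_pow, ← pow_mul, pow_add, pow_add]; ring
    _ ≤ (n : ℝ) ^ (2 * i) * x ^ (2 * ((i + 2).choose 2 - 1)) := by
        rw [show 2 * i - l + l = 2 * i by omega]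
        gcongr ?_ * ?_
        exact pow_le_pow_of_le_one hx0.le hx1 hexp

/-- This compares cliques one dimension higher with the squared influence. The three summands on the
right serve the overlaps `l = 0`, `l = 1` and `l ≥ 2` respectively. -/
theorem pow_mul_pow_le_mul {i l n : ℕ} {x : ℝ} (hx0 : 0 < x) (hx1 : x ≤ 1)
    (hw : 1 ≤ n * x ^ (i + 1)) (hli : l ≤ i + 1) :
    (n : ℝ) ^ (2 * (i + 1) - l) * x ^ (2 * (i + 3).choose 2 - 1 - (l + 2).choose 2) ≤
      (n : ℝ) ^ (2 * i) * x ^ (2 * ((i + 2).choose 2 - 1)) *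
        ((n * x ^ (i + 2)) ^ 2 + n * x ^ (i + 2) + x) := by
  have hi := two_mul_choose_two i
  have hi' := two_mul_choose_two (i + 1)
  have hl := two_mul_choose_two l
  have hK : (i + 3).choose 2 = (i + 2).choose 2 + (i + 2) := by nlinarith
  have hK1 : 1 ≤ (i + 2).choose 2 := Nat.choose_pos (by omega)
  have hn0 : (0 : ℝ) ≤ n := n.cast_nonneg
  set B : ℝ := (n : ℝ) ^ (2 * i) * x ^ (2 * ((i + 2).choose 2 - 1)) with hB
  have hB0 : 0 ≤ B := by positivity
  have hv0 : 0 ≤ n * x ^ (i + 2) := by positivity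
  rcases Nat.lt_or_ge l 2 with hl2 | hl2
  · interval_cases l
    · refine le_trans (le_of_eq (b := B * (n * x ^ (i + 2)) ^ 2) ?_)
        (mul_le_mul_of_nonneg_left (by linarith) hB0)
      rw [hB, hK, mul_pow, ← pow_mul, Nat.choose_self,
        show 2 * ((i + 2).choose 2 + (i + 2)) - 1 - 1 =
          2 * ((i + 2).choose 2 - 1) + (i + 2) * 2 by omega, pow_add,
        show 2 * (i + 1) - 0 = 2 * i + 2 by omega, pow_add]
      ring
    · refine le_trans (b := B * (n * x ^ (i + 2))) ?_
        (mul_le_mul_of_nonneg_left (by nlinarith) hB0)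
      rw [hB, hK, show Nat.choose (1 + 2) 2 = 3 from rfl,
        show 2 * (i + 1) - 1 = 2 * i + 1 by omega, pow_succ (n : ℝ)]
      have : x ^ (2 * ((i + 2).choose 2 + (i + 2)) - 1 - 3) ≤
          x ^ (2 * ((i + 2).choose 2 - 1)) * x ^ (i + 2) := by
        rw [← pow_add]
        exact pow_le_pow_of_le_one hx0.le hx1 (by omega)
      calc _ ≤ (n : ℝ) ^ (2 * i) * n * (x ^ (2 * ((i + 2).choose 2 - 1)) * x ^ (i + 2)) := by
            gcongr
        _ = _ := by ring
  · refine le_trans (b := B * x) ?_ (mul_le_mul_of_nonneg_left (by nlinarith) hB0)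
    obtain ⟨j, rfl⟩ := Nat.exists_eq_add_of_le' hl2
    have hle : (j + 2 + 2).choose 2 ≤ (i + 3).choose 2 := Nat.choose_le_choose 2 (by omega)
    have hexp : 2 * ((i + 2).choose 2 - 1) + 1 ≤
        2 * (i + 3).choose 2 - 1 - (j + 2 + 2).choose 2 + (i + 1) * j := by
      have h1 : (j + 2 + 2).choose 2 ≤ (i + 1) * (j + 2) + 2 := by nlinarith
      have h2 : (i + 1) * (j + 2) = (i + 1) * j + 2 * (i + 1) := by ring
      omega
    calc (n : ℝ) ^ (2 * (i + 1) - (j + 2)) *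
          x ^ (2 * (i + 3).choose 2 - 1 - (j + 2 + 2).choose 2)
        ≤ (n : ℝ) ^ (2 * (i + 1) - (j + 2)) *
          x ^ (2 * (i + 3).choose 2 - 1 - (j + 2 + 2).choose 2) * (n * x ^ (i + 1)) ^ j :=
          le_mul_of_one_le_right (by positivity) (one_le_pow₀ hw)
      _ = (n : ℝ) ^ (2 * (i + 1) - (j + 2) + j) *
          x ^ (2 * (i + 3).choose 2 - 1 - (j + 2 + 2).choose 2 + (i + 1) * j) := by
          rw [mul_pow, ← pow_mul, pow_add, pow_add]; ring
      _ ≤ (n : ℝ) ^ (2 * i) * x ^ (2 * ((i + 2).choose 2 - 1) + 1) := by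
          rw [show 2 * (i + 1) - (j + 2) + j = 2 * i by omega]
          gcongr ?_ * ?_
          exact pow_le_pow_of_le_one hx0.le hx1 hexp
      _ = B * x := by rw [hB, pow_succ]; ring

theorem pow_mul_pow_le_meanInfluence_sq {n i : ℕ} (hn : 2 * (i + 2) ≤ n) {x : ℝ} (hx : 0 ≤ x) :
    (n : ℝ) ^ (2 * i) * x ^ (2 * ((i + 2).choose 2 - 1)) ≤
      (2 ^ i * i.factorial) ^ 2 * meanInfluence n i x ^ 2 := by
  have h1 : (n : ℝ) ^ i ≤ 2 ^ i * i.factorial * (n - 2).choose i := by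
    have h := Nat.pow_sub_le_descFactorial (n - 2) i
    rw [Nat.descFactorial_eq_factorial_mul_choose] at h
    have h2 : n ^ i ≤ (2 * (n - 2 + 1 - i)) ^ i := Nat.pow_le_pow_left (by omega) i
    have h3 : n ^ i ≤ 2 ^ i * i.factorial * (n - 2).choose i := by
      rw [mul_pow] at h2
      calc n ^ i ≤ _ := h2
        _ ≤ 2 ^ i * (i.factorial * (n - 2).choose i) := Nat.mul_le_mul_left _ h
        _ = _ := by ring
    exact_mod_cast h3
  unfold meanInfluence
  calc (n : ℝ) ^ (2 * i) * x ^ (2 * ((i + 2).choose 2 - 1))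
      = ((n : ℝ) ^ i * x ^ ((i + 2).choose 2 - 1)) ^ 2 := by
        rw [mul_pow, ← pow_mul, ← pow_mul]; ring
    _ ≤ (2 ^ i * i.factorial * (n - 2).choose i * x ^ ((i + 2).choose 2 - 1)) ^ 2 := by gcongr
    _ = _ := by ring

variable {V : Type*} [LinearOrder V] [Fintype V]

/-- A bound for the relative error in the approximation of a Betti number by a multiple of the
number of edges. -/
noncomputable def linearizationError (n i : ℕ) (x : ℝ) : ℝ :=
  3 * (2 * (i * 2 ^ (i + 2) * (2 ^ i * i.factorial) ^ 2 / (n * x ^ (i + 1))) +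
    2 * (((i + 2).choose 2 + 4) / √(n * x ^ (i + 1))) +
    (i + 2) * 2 ^ (i + 3) * (2 ^ i * i.factorial) ^ 2 *
      ((n * x ^ (i + 2)) ^ 2 + n * x ^ (i + 2) + x))

theorem variance_discreteDeriv_cliqueCount_le_meanInfluence {i : ℕ}
    (hn : 2 * (i + 2) ≤ Fintype.card V) {x : ℝ} (hx0 : 0 < x) (hx1 : x ≤ 1)
    (hw : 1 ≤ Fintype.card V * x ^ (i + 1)) {e : Sym2 V} (he : ¬e.IsDiag) :
    bernoulliMean (allEdges V) x
        (fun S => (discreteDeriv e (fun S => (cliqueCount (i + 1) (ofEdges S) : ℝ)) S -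
          meanInfluence (Fintype.card V) i x) ^ 2) ≤
      i * 2 ^ (i + 2) * (2 ^ i * i.factorial) ^ 2 / (Fintype.card V * x ^ (i + 1)) *
        meanInfluence (Fintype.card V) i x ^ 2 := by
  refine (variance_discreteDeriv_cliqueCount_le i hx0.le he).trans ?_
  set n := Fintype.card V
  set m := meanInfluence n i x
  calc _ ≤ ∑ l ∈ Icc 1 i, 2 ^ (i + 2) *
        ((2 ^ i * i.factorial) ^ 2 * m ^ 2 / (n * x ^ (i + 1))) := by
        refine sum_le_sum fun l hl => ?_
        obtain ⟨h1, h2⟩ := mem_Icc.1 hl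
        refine mul_le_mul_of_nonneg_left ((pow_mul_pow_le_div hx0 hx1 hw h1 h2).trans ?_)
          (by positivity)
        exact div_le_div_of_nonneg_right (pow_mul_pow_le_meanInfluence_sq hn hx0.le) (by linarith)
    _ = _ := by
        rw [sum_const, Nat.card_Icc, nsmul_eq_mul, Nat.add_sub_cancel]
        ring

theorem mean_sq_discreteDeriv_cliqueRank_le {i : ℕ}
    (hn : 2 * (i + 2) ≤ Fintype.card V) {x : ℝ} (hx0 : 0 < x) (hx1 : x ≤ 1)
    (hw : 1 ≤ Fintype.card V * x ^ (i + 1)) {e : Sym2 V} (he : ¬e.IsDiag) :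
    bernoulliMean (allEdges V) x
        (fun S => discreteDeriv e (fun S => (cliqueRank (i + 2) (ofEdges S) : ℝ)) S ^ 2) ≤
      (i + 2) * 2 ^ (i + 3) * (2 ^ i * i.factorial) ^ 2 * ((Fintype.card V * x ^ (i + 2)) ^ 2 +
        Fintype.card V * x ^ (i + 2) + x) * meanInfluence (Fintype.card V) i x ^ 2 := by
  refine le_trans (bernoulliMean_mono hx0.le hx1 (G := fun S => discreteDeriv e
    (fun S => (cliqueCount (i + 1 + 1) (ofEdges S) : ℝ)) S ^ 2) fun S _ => ?_)
    ((bernoulliMean_sq_discreteDeriv_cliqueCount_le (i + 1) hx0.le he).trans ?_)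
  · have h1 := discreteDeriv_cliqueNullity_add_cliqueRank (i + 2) e S
    have h2 := discreteDeriv_cliqueNullity_nonneg (i + 2) e S
    have h3 := discreteDeriv_cliqueRank_nonneg (i + 2) e S
    exact pow_le_pow_left₀ h3 (by linarith) 2
  set n := Fintype.card V
  set m := meanInfluence n i x
  set Q : ℝ := (n * x ^ (i + 2)) ^ 2 + n * x ^ (i + 2) + x with hQ
  have hQ0 : 0 ≤ Q := by positivity
  calc _ ≤ ∑ l ∈ range (i + 1 + 1), 2 ^ (i + 3) * ((2 ^ i * i.factorial) ^ 2 * m ^ 2 * Q) := by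
        refine sum_le_sum fun l hl => ?_
        refine mul_le_mul_of_nonneg_left ((pow_mul_pow_le_mul hx0 hx1 hw
          (Nat.lt_succ_iff.1 (mem_range.1 hl))).trans ?_) (by positivity)
        exact mul_le_mul_of_nonneg_right (pow_mul_pow_le_meanInfluence_sq hn hx0.le) hQ0
    _ = _ := by
        rw [sum_const, card_range, nsmul_eq_mul]
        push_cast
        ring

/-- The Betti number, as a function of the edge set. -/
noncomputable def edgeBetti (i : ℕ) (S : Finset (Sym2 V)) : ℝ :=
  (ofEdges S).cliqueComplex.betti (i + 1)

theorem edgeBetti_eq (i : ℕ) (S : Finset (Sym2 V)) :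
    edgeBetti i S = cliqueNullity (i + 1) (ofEdges S) - cliqueRank (i + 2) (ofEdges S) := by
  rw [edgeBetti, ← betti_cliqueComplex]
  push_cast
  ring

/-- The deviation is the sum of three errors: fluctuation of the clique count, rank in the same
dimension, and rank one dimension up. Only the first moment of the middle one is available, summed
over all edges. -/
theorem sum_mean_sq_discreteDeriv_edgeBetti_sub_le {i : ℕ}
    (hn : 2 * (i + 2) ≤ Fintype.card V) {x : ℝ} (hx0 : 0 < x) (hx1 : x ≤ 1)
    (hw : 1 ≤ Fintype.card V * x ^ (i + 1)) :
    ∑ e ∈ allEdges V, bernoulliMean (allEdges V) x (fun S =>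
      (discreteDeriv e (edgeBetti i) S - meanInfluence (Fintype.card V) i x) ^ 2) ≤
      (Fintype.card V).choose 2 * meanInfluence (Fintype.card V) i x ^ 2 *
        linearizationError (Fintype.card V) i x := by
  set n := Fintype.card V with hndef
  set m := meanInfluence n i x with hm
  have hm0 : 0 ≤ m := meanInfluence_nonneg n i hx0.le
  set U := allEdges V
  have hsw : 1 ≤ √(n * x ^ (i + 1)) := Real.one_le_sqrt.2 hw
  -- With w = n x^(i+1), the choice δ = w^(-1/2) balances the errors of order δ and 1/(w δ).
  have hR := sum_mean_discreteDeriv_cliqueRank_le (V := V) hn hx0 hx1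
    (δ := (√(n * x ^ (i + 1)))⁻¹) (by positivity) (inv_le_one_of_one_le₀ hsw)
  have hcoef : ((i + 2).choose 2 * (√(n * x ^ (i + 1)))⁻¹ +
      4 / (n * x ^ (i + 1) * (√(n * x ^ (i + 1)))⁻¹) : ℝ) =
      ((i + 2).choose 2 + 4) / √(n * x ^ (i + 1)) := by
    have hsq := Real.mul_self_sqrt (show 0 ≤ n * x ^ (i + 1) by linarith)
    set s := √(n * x ^ (i + 1))
    rw [← hsq]
    have : s ≠ 0 := by positivity
    field_simp
  rw [← hndef, hcoef, ← hm] at hR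
  have hpoint : ∀ e ∈ U, bernoulliMean U x (fun S => (discreteDeriv e (edgeBetti i) S - m) ^ 2) ≤
      3 * (2 * bernoulliMean U x (fun S =>
        (discreteDeriv e (fun S => (cliqueCount (i + 1) (ofEdges S) : ℝ)) S - m) ^ 2) +
      2 * m * bernoulliMean U x
        (discreteDeriv e fun S => (cliqueRank (i + 1) (ofEdges S) : ℝ)) +
      bernoulliMean U x
        (fun S => discreteDeriv e (fun S => (cliqueRank (i + 2) (ofEdges S) : ℝ)) S ^ 2)) := by
    intro e _
    rw [← bernoulliMean_mul_left, ← bernoulliMean_mul_left, ← bernoulliMean_add,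
      ← bernoulliMean_add, ← bernoulliMean_mul_left]
    refine bernoulliMean_mono hx0.le hx1 fun S _ => ?_
    have h1 := discreteDeriv_cliqueNullity_add_cliqueRank (i + 1) e S
    have h2 := discreteDeriv_cliqueNullity_nonneg (i + 1) e S
    have h3 := discreteDeriv_cliqueRank_nonneg (i + 1) e S
    have h4 : discreteDeriv e (edgeBetti i) S =
        discreteDeriv e (fun S => (cliqueNullity (i + 1) (ofEdges S) : ℝ)) S -
        discreteDeriv e (fun S => (cliqueRank (i + 2) (ofEdges S) : ℝ)) S := by
      simp only [discreteDeriv, edgeBetti_eq]; ring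
    rw [h4]
    generalize discreteDeriv e (fun S => (cliqueNullity (i + 1) (ofEdges S) : ℝ)) S = z at *
    generalize discreteDeriv e (fun S => (cliqueRank (i + 1) (ofEdges S) : ℝ)) S = r at *
    generalize discreteDeriv e (fun S => (cliqueRank (i + 2) (ofEdges S) : ℝ)) S = s at *
    generalize discreteDeriv e (fun S => (cliqueCount (i + 1) (ofEdges S) : ℝ)) S = f at *
    obtain rfl : z = f - r := by linarith
    -- As 0 ≤ r ≤ f, one has r² ≤ r f = r m + r (f - m), and the last product is at most (r² + (f -
    -- m)²)/2.
    have hr : r ^ 2 ≤ 2 * m * r + (f - m) ^ 2 := by nlinarith [sq_nonneg (f - m - r)]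
    nlinarith [sq_nonneg (f - m + r), sq_nonneg (f - m + s), sq_nonneg (r - s)]
  calc _ ≤ _ := sum_le_sum hpoint
    _ = 3 * (2 * ∑ e ∈ U, bernoulliMean U x (fun S =>
          (discreteDeriv e (fun S => (cliqueCount (i + 1) (ofEdges S) : ℝ)) S - m) ^ 2) +
        2 * m * ∑ e ∈ U, bernoulliMean U x
          (discreteDeriv e fun S => (cliqueRank (i + 1) (ofEdges S) : ℝ)) +
        ∑ e ∈ U, bernoulliMean U x
          (fun S => discreteDeriv e (fun S => (cliqueRank (i + 2) (ofEdges S) : ℝ)) S ^ 2)) := by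
        rw [mul_sum, mul_sum, ← sum_add_distrib, ← sum_add_distrib, mul_sum]
    _ ≤ 3 * (2 * ∑ e ∈ U, (i * 2 ^ (i + 2) * (2 ^ i * i.factorial) ^ 2 / (n * x ^ (i + 1)) *
          m ^ 2) +
        2 * m * (n.choose 2 * m * (((i + 2).choose 2 + 4) / √(n * x ^ (i + 1)))) +
        ∑ e ∈ U, ((i + 2) * 2 ^ (i + 3) * (2 ^ i * i.factorial) ^ 2 * ((n * x ^ (i + 2)) ^ 2 +
          n * x ^ (i + 2) + x) * m ^ 2)) := by
        gcongr with e he e he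
        · exact variance_discreteDeriv_cliqueCount_le_meanInfluence hn hx0 hx1 hw
            (not_isDiag_of_mem_allEdges he)
        · exact mean_sq_discreteDeriv_cliqueRank_le hn hx0 hx1 hw (not_isDiag_of_mem_allEdges he)
    _ = _ := by
        rw [sum_const, sum_const, card_allEdges, nsmul_eq_mul, nsmul_eq_mul, linearizationError]
        ring

/-- The Betti number is close in `L²` to a multiple of the number of edges. -/
theorem variance_edgeBetti_sub_mul_card_le {i : ℕ}
    (hn : 2 * (i + 2) ≤ Fintype.card V) {x : ℝ} (hx0 : 0 < x) (hx1 : x ≤ 1)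
    (hw : 1 ≤ Fintype.card V * x ^ (i + 1)) :
    bernoulliMean (allEdges V) x
        (fun S => (edgeBetti i S - meanInfluence (Fintype.card V) i x * #S) ^ 2) -
      bernoulliMean (allEdges V) x
        (fun S => edgeBetti i S - meanInfluence (Fintype.card V) i x * #S) ^ 2 ≤
      meanInfluence (Fintype.card V) i x ^ 2 * ((Fintype.card V).choose 2 * x * (1 - x)) *
        linearizationError (Fintype.card V) i x := by
  refine (bernoulliMean_sq_sub_sq_le hx0.le hx1 _ _).trans ?_
  have h := mul_le_mul_of_nonneg_left
    (sum_mean_sq_discreteDeriv_edgeBetti_sub_le (V := V) hn hx0 hx1 hw)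
    (mul_nonneg hx0.le (sub_nonneg.2 hx1))
  refine le_trans (le_of_eq ?_) (h.trans (le_of_eq (by ring)))
  congr 1
  refine sum_congr rfl fun e _ => bernoulliMean_congr _ fun S _ => ?_
  congr 1
  -- The edge count has derivative 1 in every direction, so subtracting `m * #S` recentres the
  -- derivative at `m`.
  have : (#(insert e S) : ℝ) = #(S.erase e) + 1 := by
    rw [← card_erase_add_one (mem_insert_self e S), erase_insert_eq_erase]
    push_cast
    rfl
  simp only [discreteDeriv, this]
  ring

end SimpleGraph

/-! ### Characteristic functions and normal approximation of the binomial. -/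

theorem norm_pow_sub_pow_le_mul {a b : ℂ} (ha : ‖a‖ ≤ 1) (hb : ‖b‖ ≤ 1) (N : ℕ) :
    ‖a ^ N - b ^ N‖ ≤ N * ‖a - b‖ := by
  induction N with
  | zero => simp
  | succ N ih =>
    have h : a ^ (N + 1) - b ^ (N + 1) = a * (a ^ N - b ^ N) + (a - b) * b ^ N := by ring
    have h1 : ‖a * (a ^ N - b ^ N)‖ ≤ N * ‖a - b‖ := by
      rw [norm_mul]
      exact (mul_le_of_le_one_left (norm_nonneg _) ha).trans ih
    have h2 : ‖(a - b) * b ^ N‖ ≤ ‖a - b‖ := by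
      rw [norm_mul, norm_pow]
      exact mul_le_of_le_one_right (norm_nonneg _) (pow_le_one₀ (norm_nonneg _) hb)
    rw [h]
    push_cast
    linarith [norm_add_le (a * (a ^ N - b ^ N)) ((a - b) * b ^ N)]

theorem norm_exp_ofReal_mul_I_sub_taylor_le {y : ℝ} (hy : |y| ≤ 1) :
    ‖Complex.exp (y * Complex.I) - (1 + y * Complex.I - y ^ 2 / 2)‖ ≤ 3 * |y| ^ 3 := by
  have h := Complex.norm_exp_sub_sum_le_norm_mul_exp (y * Complex.I) 3
  have hs : ∑ m ∈ Finset.range 3, (y * Complex.I) ^ m / (m.factorial : ℂ) =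
      1 + y * Complex.I - y ^ 2 / 2 := by
    simp [Finset.sum_range_succ, mul_pow]
    ring
  have hn : ‖(y * Complex.I : ℂ)‖ = |y| := by simp
  rw [hs, hn] at h
  have he : Real.exp |y| ≤ 3 :=
    (Real.exp_le_exp.2 hy).trans (by linarith [Real.exp_one_lt_d9])
  calc _ ≤ _ := h
    _ ≤ |y| ^ 3 * 3 := by gcongr
    _ = _ := mul_comm _ _

/-- Centring cancels the linear Taylor terms. Keeping the factor `x * (1 - x)` in the error matters:
summed over all trials it becomes the variance, which suits probabilities tending to 0. -/
theorem norm_bernoulli_charFun_sub_le {x u : ℝ} (hx0 : 0 ≤ x) (hx1 : x ≤ 1) (hu : |u| ≤ 1) :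
    ‖(x * Complex.exp ((u * (1 - x) : ℝ) * Complex.I) +
      (1 - x) * Complex.exp ((-(u * x) : ℝ) * Complex.I)) -
      ((1 - u ^ 2 * (x * (1 - x)) / 2 : ℝ) : ℂ)‖ ≤ 3 * |u| ^ 3 * (x * (1 - x)) := by
  have hx' : 0 ≤ 1 - x := by linarith
  have a1 : |u * (1 - x)| = |u| * (1 - x) := by rw [abs_mul, abs_of_nonneg hx']
  have a2 : |-(u * x)| = |u| * x := by rw [abs_neg, abs_mul, abs_of_nonneg hx0]
  have h1 := norm_exp_ofReal_mul_I_sub_taylor_le (y := u * (1 - x))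
    (by rw [a1]; exact mul_le_one₀ hu hx' (by linarith))
  have h2 := norm_exp_ofReal_mul_I_sub_taylor_le (y := -(u * x))
    (by rw [a2]; exact mul_le_one₀ hu hx0 hx1)
  rw [a1] at h1
  rw [a2] at h2
  set E1 := Complex.exp ((u * (1 - x) : ℝ) * Complex.I)
  set E2 := Complex.exp ((-(u * x) : ℝ) * Complex.I)
  set T1 : ℂ := 1 + (u * (1 - x) : ℝ) * Complex.I - (u * (1 - x) : ℝ) ^ 2 / 2 with hT1
  set T2 : ℂ := 1 + (-(u * x) : ℝ) * Complex.I - (-(u * x) : ℝ) ^ 2 / 2 with hT2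
  have hid : (x * E1 + (1 - x) * E2) - ((1 - u ^ 2 * (x * (1 - x)) / 2 : ℝ) : ℂ) =
      (x : ℂ) * (E1 - T1) + ((1 - x : ℝ) : ℂ) * (E2 - T2) := by
    rw [hT1, hT2]; push_cast; ring
  rw [hid]
  refine (norm_add_le _ _).trans ?_
  rw [norm_mul, norm_mul, Complex.norm_real, Complex.norm_real, Real.norm_of_nonneg hx0,
    Real.norm_of_nonneg hx']
  have hq : (1 - x) ^ 2 + x ^ 2 ≤ 1 := by nlinarith
  calc x * ‖E1 - T1‖ + (1 - x) * ‖E2 - T2‖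
      ≤ x * (3 * (|u| * (1 - x)) ^ 3) + (1 - x) * (3 * (|u| * x) ^ 3) := by gcongr
    _ = 3 * |u| ^ 3 * (x * (1 - x)) * ((1 - x) ^ 2 + x ^ 2) := by ring
    _ ≤ 3 * |u| ^ 3 * (x * (1 - x)) * 1 := by gcongr
    _ = _ := mul_one _

namespace Finset

variable {α : Type*} [DecidableEq α]

theorem norm_bernoulliMean_le {U : Finset α} {x : ℝ} (hx0 : 0 ≤ x) (hx1 : x ≤ 1)
    (F : Finset α → ℂ) : ‖bernoulliMean U x F‖ ≤ bernoulliMean U x (fun S => ‖F S‖) := by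
  unfold bernoulliMean
  refine (norm_sum_le _ _).trans (sum_le_sum fun S _ => ?_)
  rw [norm_smul, Real.norm_of_nonneg
    (mul_nonneg (pow_nonneg hx0 _) (pow_nonneg (by linarith) _)), smul_eq_mul]

theorem bernoulliMean_card (U : Finset α) (x : ℝ) :
    bernoulliMean U x (fun S => (#S : ℝ)) = #U * x := by
  induction U using Finset.induction_on with
  | empty => simp [bernoulliMean_empty]
  | insert a U ha ih =>
    have h : bernoulliMean U x (fun S => (#(insert a S) : ℝ)) = #U * x + 1 := by
      rw [← ih, ← bernoulliMean_const U x (1 : ℝ), ← bernoulliMean_add]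
      refine bernoulliMean_congr _ fun S hS => ?_
      rw [card_insert_of_notMem fun h => ha (hS h)]
      push_cast; rfl
    rw [bernoulliMean_insert ha, ih, h, card_insert_of_notMem ha]
    simp only [smul_eq_mul]
    push_cast
    ring

theorem bernoulliMean_card_sub_sq (U : Finset α) (x c : ℝ) :
    bernoulliMean U x (fun S => ((#S : ℝ) - c) ^ 2) = #U * x * (1 - x) + (#U * x - c) ^ 2 := by
  induction U using Finset.induction_on generalizing c with
  | empty => simp [bernoulliMean_empty]
  | insert a U ha ih =>
    have h : bernoulliMean U x (fun S => ((#(insert a S) : ℝ) - c) ^ 2) =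
        bernoulliMean U x (fun S => ((#S : ℝ) - (c - 1)) ^ 2) := by
      refine bernoulliMean_congr _ fun S hS => ?_
      rw [card_insert_of_notMem fun h => ha (hS h)]
      push_cast; ring
    rw [bernoulliMean_insert ha, h, ih, ih, card_insert_of_notMem ha]
    simp only [smul_eq_mul]
    push_cast
    ring

/-- The characteristic function of the centered number of successes. -/
theorem bernoulliMean_exp_card (U : Finset α) (x u : ℝ) :
    bernoulliMean U x (fun S => Complex.exp ((u * (#S - #U * x) : ℝ) * Complex.I)) =
      (x * Complex.exp ((u * (1 - x) : ℝ) * Complex.I) +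
        (1 - x) * Complex.exp ((-(u * x) : ℝ) * Complex.I)) ^ #U := by
  have h1 : ∀ S : Finset α, Complex.exp ((u * (#S - #U * x) : ℝ) * Complex.I) =
      Complex.exp ((-(u * x) : ℝ) * Complex.I) ^ #U * Complex.exp (u * Complex.I) ^ #S := by
    intro S
    rw [← Complex.exp_nat_mul, ← Complex.exp_nat_mul, ← Complex.exp_add]
    congr 1
    push_cast
    ring
  have h2 : Complex.exp ((u * (1 - x) : ℝ) * Complex.I) =
      Complex.exp (u * Complex.I) * Complex.exp ((-(u * x) : ℝ) * Complex.I) := by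
    rw [← Complex.exp_add]
    congr 1
    push_cast
    ring
  have h3 : bernoulliMean U x (fun S => Complex.exp ((u * (#S - #U * x) : ℝ) * Complex.I)) =
      Complex.exp ((-(u * x) : ℝ) * Complex.I) ^ #U *
        bernoulliMean U x (fun S => Complex.exp (u * Complex.I) ^ #S) := by
    simp only [h1, bernoulliMean, mul_sum, mul_smul_comm]
  rw [h3, bernoulliMean_pow_card, h2, ← mul_pow]
  congr 1
  ring

/-- A quantitative de Moivre–Laplace theorem for characteristic functions. -/
theorem norm_bernoulliMean_exp_card_sub_le {U : Finset α} {x s t : ℝ} (hx0 : 0 ≤ x) (hx1 : x ≤ 1)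
    (hs : s ^ 2 = #U * x * (1 - x)) (hs0 : 0 < s) (hst : |t| ≤ s) :
    ‖bernoulliMean U x (fun S => Complex.exp ((t * ((#S - #U * x) / s) : ℝ) * Complex.I)) -
      Complex.exp (-(t ^ 2 / 2))‖ ≤ 3 * |t| ^ 3 / s + t ^ 4 / s ^ 2 := by
  have hx' : 0 ≤ 1 - x := by linarith
  have hN : s ^ 2 ≤ #U := by
    rw [hs]
    have : x * (1 - x) ≤ 1 := by nlinarith
    calc (#U : ℝ) * x * (1 - x) = #U * (x * (1 - x)) := by ring
      _ ≤ #U * 1 := by gcongr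
      _ = _ := mul_one _
  have hN0 : (0 : ℝ) < #U := lt_of_lt_of_le (by positivity) hN
  set u := t / s with hu
  have hu1 : |u| ≤ 1 := by
    rw [hu, abs_div, abs_of_pos hs0]
    exact (div_le_one hs0).2 hst
  have hrw : (fun S : Finset α => Complex.exp ((t * ((#S - #U * x) / s) : ℝ) * Complex.I)) =
      fun S => Complex.exp ((u * (#S - #U * x) : ℝ) * Complex.I) := by
    ext S; rw [hu]; congr 3; ring
  rw [hrw, bernoulliMean_exp_card]
  set φ : ℂ := x * Complex.exp ((u * (1 - x) : ℝ) * Complex.I) +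
    (1 - x) * Complex.exp ((-(u * x) : ℝ) * Complex.I) with hφ
  have hφ1 : ‖φ‖ ≤ 1 := by
    have h1x : ‖(1 - x : ℂ)‖ = 1 - x := by
      rw [show (1 - x : ℂ) = ((1 - x : ℝ) : ℂ) by push_cast; rfl, Complex.norm_real,
        Real.norm_of_nonneg hx']
    refine (norm_add_le _ _).trans ?_
    rw [norm_mul, norm_mul, Complex.norm_exp_ofReal_mul_I, Complex.norm_exp_ofReal_mul_I, h1x,
      Complex.norm_real, Real.norm_of_nonneg hx0]
    linarith
  set v : ℝ := t ^ 2 / (2 * #U) with hv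
  have hv0 : 0 ≤ v := by positivity
  have ht2 : t ^ 2 ≤ s ^ 2 := sq_le_sq.2 (by rwa [abs_of_pos hs0])
  have hv1 : v ≤ 1 := by
    rw [hv, div_le_one (by positivity)]
    linarith
  have huv : u ^ 2 * (x * (1 - x)) / 2 = v := by
    have : x * (1 - x) = s ^ 2 / #U := by rw [hs]; field_simp
    rw [this, hu, hv]
    field_simp
  -- The Gaussian is split into `#U` equal factors, to be compared with the characteristic function
  -- of a single trial.
  have hb : Complex.exp (-(t ^ 2 / 2)) = ((Real.exp (-v) : ℝ) : ℂ) ^ #U := by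
    rw [Complex.ofReal_exp, ← Complex.exp_nat_mul]
    congr 1
    rw [hv]
    push_cast
    have : (#U : ℂ) ≠ 0 := by exact_mod_cast hN0.ne'
    field_simp
  have hb1 : ‖((Real.exp (-v) : ℝ) : ℂ)‖ ≤ 1 := by
    rw [Complex.norm_real, Real.norm_of_nonneg (Real.exp_pos _).le]
    exact Real.exp_le_one_iff.2 (by linarith)
  rw [hb]
  refine (norm_pow_sub_pow_le_mul hφ1 hb1 _).trans ?_
  have e1 := norm_bernoulli_charFun_sub_le hx0 hx1 hu1
  rw [← hφ, huv] at e1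
  have e2 : ‖((1 - v : ℝ) : ℂ) - ((Real.exp (-v) : ℝ) : ℂ)‖ ≤ v ^ 2 := by
    rw [← Complex.ofReal_sub, Complex.norm_real, Real.norm_eq_abs, abs_sub_comm]
    have := Real.abs_exp_sub_one_sub_id_le (x := -v) (by rwa [abs_neg, abs_of_nonneg hv0])
    rw [neg_sq] at this
    convert this using 2
    ring
  have e3 : ‖φ - ((Real.exp (-v) : ℝ) : ℂ)‖ ≤ 3 * |u| ^ 3 * (x * (1 - x)) + v ^ 2 :=
    (norm_sub_le_norm_sub_add_norm_sub _ _ _).trans (add_le_add e1 e2)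
  calc #U * ‖φ - ((Real.exp (-v) : ℝ) : ℂ)‖
      ≤ #U * (3 * |u| ^ 3 * (x * (1 - x)) + v ^ 2) := by gcongr
    _ = 3 * |u| ^ 3 * (#U * x * (1 - x)) + t ^ 4 / (4 * #U) := by
        rw [hv]; field_simp; ring
    _ = 3 * |t| ^ 3 / s + t ^ 4 / (4 * #U) := by
        rw [← hs, hu, abs_div, abs_of_pos hs0]; field_simp
    _ ≤ 3 * |t| ^ 3 / s + t ^ 4 / s ^ 2 := by
        gcongr
        linarith

/-- The map y ↦ exp(i t y) is Lipschitz with constant |t|, and Jensen passes from the first absolute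
moment to the L² norm. -/
theorem norm_bernoulliMean_exp_sub_le {U : Finset α} {x : ℝ} (hx0 : 0 ≤ x) (hx1 : x ≤ 1) (t : ℝ)
    (X Y : Finset α → ℝ) :
    ‖bernoulliMean U x (fun S => Complex.exp ((t * X S : ℝ) * Complex.I)) -
      bernoulliMean U x (fun S => Complex.exp ((t * Y S : ℝ) * Complex.I))‖ ≤
      |t| * √(bernoulliMean U x (fun S => (X S - Y S) ^ 2)) := by
  rw [← bernoulliMean_sub]
  refine (norm_bernoulliMean_le hx0 hx1 _).trans ?_
  have h1 : bernoulliMean U x (fun S => ‖Complex.exp ((t * X S : ℝ) * Complex.I) -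
      Complex.exp ((t * Y S : ℝ) * Complex.I)‖) ≤ bernoulliMean U x (fun S => |t| * |X S - Y S|) := by
    refine bernoulliMean_mono hx0 hx1 fun S _ => ?_
    have : Complex.exp ((t * X S : ℝ) * Complex.I) - Complex.exp ((t * Y S : ℝ) * Complex.I) =
        Complex.exp ((t * Y S : ℝ) * Complex.I) *
          (Complex.exp (Complex.I * (t * (X S - Y S) : ℝ)) - 1) := by
      rw [mul_sub, ← Complex.exp_add, mul_one]
      congr 2
      push_cast
      ring
    rw [this, norm_mul, Complex.norm_exp_ofReal_mul_I, one_mul, ← abs_mul]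
    exact Real.norm_exp_I_mul_ofReal_sub_one_le
  refine h1.trans ?_
  rw [bernoulliMean_mul_left]
  refine mul_le_mul_of_nonneg_left (Real.le_sqrt_of_sq_le ?_) (abs_nonneg t)
  refine (sq_bernoulliMean_le hx0 hx1 _).trans (le_of_eq ?_)
  simp only [sq_abs]

/-- In L², ‖B/σ - A/a‖² = (‖B - A‖² - (σ - a)²)/(σ a), and closeness of `B` to `A` forces σ ≥ a/2.
No separate estimate of the variance of `B` is needed. -/
theorem bernoulliMean_sq_sub_normalized_le {U : Finset α} {x : ℝ} (hx0 : 0 ≤ x) (hx1 : x ≤ 1)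
    {A B : Finset α → ℝ} {a σ ε : ℝ} (ha : 0 < a) (hσ : 0 ≤ σ)
    (hA : bernoulliMean U x (fun S => A S ^ 2) = a ^ 2)
    (hB : bernoulliMean U x (fun S => B S ^ 2) = σ ^ 2)
    (hAB : bernoulliMean U x (fun S => (B S - A S) ^ 2) ≤ a ^ 2 * ε) (hε : ε ≤ 1 / 4) :
    bernoulliMean U x (fun S => (B S / σ - A S / a) ^ 2) ≤ 2 * ε := by
  have h1 : a ^ 2 ≤ 2 * σ ^ 2 + 2 * (a ^ 2 * ε) := by
    have : bernoulliMean U x (fun S => A S ^ 2) ≤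
        bernoulliMean U x (fun S => 2 * B S ^ 2 + 2 * (B S - A S) ^ 2) :=
      bernoulliMean_mono hx0 hx1 fun S _ => by nlinarith [sq_nonneg (2 * B S - A S)]
    rw [bernoulliMean_add, bernoulliMean_mul_left, bernoulliMean_mul_left, hA, hB] at this
    linarith
  have h2 : a / 2 ≤ σ := by
    refine le_of_sq_le_sq ?_ hσ
    have : a ^ 2 * ε ≤ a ^ 2 * (1 / 4) := by gcongr
    rw [div_pow]
    linarith
  have hσ0 : 0 < σ := by linarith
  set c := bernoulliMean U x (fun S => A S * B S) with hc
  have h3 : bernoulliMean U x (fun S => (B S - A S) ^ 2) = σ ^ 2 + a ^ 2 - 2 * c := by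
    have : (fun S => (B S - A S) ^ 2) = fun S => (B S ^ 2 + A S ^ 2) - 2 * (A S * B S) := by
      ext S; ring
    rw [this, bernoulliMean_sub, bernoulliMean_add, bernoulliMean_mul_left, hA, hB]
  have h4 : bernoulliMean U x (fun S => (B S / σ - A S / a) ^ 2) = 2 - 2 * c / (σ * a) := by
    have : (fun S => (B S / σ - A S / a) ^ 2) = fun S =>
        ((1 / σ ^ 2) * B S ^ 2 + (1 / a ^ 2) * A S ^ 2) - (2 / (σ * a)) * (A S * B S) := by
      ext S; field_simp; ring
    rw [this, bernoulliMean_sub, bernoulliMean_add, bernoulliMean_mul_left, bernoulliMean_mul_left,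
      bernoulliMean_mul_left, hA, hB, ← hc]
    field_simp
    ring
  rw [h3] at hAB
  have h5 : (σ * a) * (2 - 2 * c / (σ * a)) ≤ a ^ 2 * ε := by
    have : (σ * a) * (2 - 2 * c / (σ * a)) = 2 * (σ * a) - 2 * c := by field_simp
    rw [this]
    nlinarith [sq_nonneg (σ - a)]
  have hnn : 0 ≤ bernoulliMean U x (fun S => (B S / σ - A S / a) ^ 2) :=
    bernoulliMean_nonneg hx0 hx1 fun S _ => sq_nonneg _
  rw [h4] at hnn ⊢
  have h6 : (a / 2 * a) * (2 - 2 * c / (σ * a)) ≤ a ^ 2 * ε :=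
    le_trans (mul_le_mul_of_nonneg_right (mul_le_mul_of_nonneg_right h2 ha.le) hnn) h5
  have h7 : 0 < a ^ 2 := by positivity
  nlinarith

end Finset

/-! ### The quantitative limit theorem and its transfer to the random graph. -/

namespace SimpleGraph

open Finset Topology

theorem meanInfluence_pos {n i : ℕ} (hn : 2 * (i + 2) ≤ n) {x : ℝ} (hx : 0 < x) :
    0 < meanInfluence n i x := by
  have : 0 < (n - 2).choose i := Nat.choose_pos (by omega)
  unfold meanInfluence
  positivity

/-- A quantitative central limit theorem for the Betti numbers, on the level of characteristic
functions. -/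
theorem norm_charFun_edgeBetti_sub_le {V : Type*} [LinearOrder V] [Fintype V] {i : ℕ}
    (hn : 2 * (i + 2) ≤ Fintype.card V) {x s t : ℝ} (hx0 : 0 < x) (hx1 : x ≤ 1)
    (hw : 1 ≤ Fintype.card V * x ^ (i + 1)) (hs0 : 0 < s)
    (hs : s ^ 2 = (Fintype.card V).choose 2 * x * (1 - x)) (hst : |t| ≤ s)
    (hε : linearizationError (Fintype.card V) i x ≤ 1 / 4) :
    ‖bernoulliMean (allEdges V) x (fun S => Complex.exp
        ((t * ((edgeBetti i S - bernoulliMean (allEdges V) x (edgeBetti i)) /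
          √(bernoulliMean (allEdges V) x
            (fun S => (edgeBetti i S - bernoulliMean (allEdges V) x (edgeBetti i)) ^ 2))) : ℝ) *
          Complex.I)) - Complex.exp (-(t ^ 2 / 2))‖ ≤
      |t| * √(2 * linearizationError (Fintype.card V) i x) + (3 * |t| ^ 3 / s + t ^ 4 / s ^ 2) := by
  set U := allEdges V with hU
  set n := Fintype.card V
  set b := bernoulliMean U x (edgeBetti i) with hb
  set v := bernoulliMean U x (fun S => (edgeBetti i S - b) ^ 2) with hv
  set m := meanInfluence n i x
  set ε := linearizationError n i x
  have hm : 0 < m := meanInfluence_pos hn hx0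
  have hv0 : 0 ≤ v := bernoulliMean_nonneg hx0.le hx1 fun S _ => sq_nonneg _
  have hcard : (#U : ℝ) = n.choose 2 := by rw [hU, card_allEdges]
  have hs' : s ^ 2 = #U * x * (1 - x) := by rw [hs, hcard]
  have hA : bernoulliMean U x (fun S => (m * (#S - #U * x)) ^ 2) = (m * s) ^ 2 := by
    simp only [mul_pow]
    rw [bernoulliMean_mul_left, bernoulliMean_card_sub_sq, hs']
    ring
  have hB : bernoulliMean U x (fun S => (edgeBetti i S - b) ^ 2) = √v ^ 2 := (Real.sq_sqrt hv0).symm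
  have hAB : bernoulliMean U x (fun S => ((edgeBetti i S - b) - m * (#S - #U * x)) ^ 2) ≤
      (m * s) ^ 2 * ε := by
    have h := variance_edgeBetti_sub_mul_card_le (V := V) hn hx0 hx1 hw
    have hmean : bernoulliMean U x (fun S => edgeBetti i S - m * #S) = b - m * (#U * x) := by
      rw [bernoulliMean_sub, bernoulliMean_mul_left, bernoulliMean_card]
    have hexp : (fun S => ((edgeBetti i S - b) - m * (#S - #U * x)) ^ 2) = fun S : Finset (Sym2 V) =>
        ((edgeBetti i S - m * #S) ^ 2 - 2 * (b - m * (#U * x)) * (edgeBetti i S - m * #S)) +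
          (b - m * (#U * x)) ^ 2 := by
      ext S; ring
    rw [hexp, bernoulliMean_add, bernoulliMean_sub, bernoulliMean_mul_left, bernoulliMean_const,
      hmean]
    rw [hmean, ← hs] at h
    rw [mul_pow]
    linarith
  have hclose := bernoulliMean_sq_sub_normalized_le hx0.le hx1 (mul_pos hm hs0) (Real.sqrt_nonneg v)
    hA hB hAB hε
  have h1 := norm_bernoulliMean_exp_sub_le (U := U) hx0.le hx1 t
    (fun S => (edgeBetti i S - b) / √v) (fun S => m * (#S - #U * x) / (m * s))
  have h2 := norm_bernoulliMean_exp_card_sub_le (U := U) hx0.le hx1 hs' hs0 hst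
  have h3 : (fun S : Finset (Sym2 V) => Complex.exp
      ((t * (m * (#S - #U * x) / (m * s)) : ℝ) * Complex.I)) =
      fun S => Complex.exp ((t * ((#S - #U * x) / s) : ℝ) * Complex.I) := by
    ext S
    rw [mul_div_mul_left _ _ hm.ne']
  rw [h3] at h1
  refine (norm_sub_le_norm_sub_add_norm_sub _ _ _).trans (add_le_add (h1.trans ?_) h2)
  gcongr

instance discreteMeasurableSpace_fin (n : ℕ) : DiscreteMeasurableSpace (SimpleGraph (Fin n)) := by
  have : MeasurableSingletonClass (SimpleGraph (Fin n)) :=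
    ⟨fun G => by
      have h := measurableEmbedding_edgeSet (V := Fin n)
      rw [← Set.preimage_image_eq {G} h.injective, Set.image_singleton]
      exact h.measurable (measurableSet_singleton _)⟩
  infer_instance

/-- Graphs correspond bijectively to sets of non-diagonal pairs, so integrals over the random graph
are the finite sums estimated above. -/
theorem integral_binomialRandom {E : Type*} [NormedAddCommGroup E] [NormedSpace ℝ E]
    [CompleteSpace E] {n : ℕ} (p : unitInterval) (Φ : SimpleGraph (Fin n) → E) :
    ∫ G, Φ G ∂binomialRandom (Fin n) p =
      bernoulliMean (allEdges (Fin n)) p (fun S => Φ (ofEdges S)) := by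
  classical
  have := Fintype.ofFinite (SimpleGraph (Fin n))
  rw [integral_fintype .of_finite, bernoulliMean]
  refine sum_bij' (fun G _ => G.edgeFinset) (fun S _ => ofEdges S) ?_ ?_ ?_ ?_ ?_
  · intro G _
    refine mem_powerset.2 fun e he => mem_edges.2 ⟨fun _ _ => mem_univ _, ?_⟩
    exact G.not_isDiag_of_mem_edgeSet (mem_edgeFinset.1 he)
  · exact fun S _ => mem_univ _
  · intro G _
    simp [ofEdges]
  · intro S hS
    ext e
    simp only [mem_edgeFinset, edgeSet_fromEdgeSet, Set.mem_sdiff, mem_coe]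
    exact and_iff_left_of_imp fun he => not_isDiag_of_mem_allEdges (mem_powerset.1 hS he)
  · intro G _
    have h1 : ofEdges G.edgeFinset = G := by simp [ofEdges]
    have h2 : G.edgeSet.ncard = #G.edgeFinset := by
      rw [← coe_edgeFinset, Set.ncard_coe_finset]
    rw [h1, Measure.real, binomialRandom_singleton, card_allEdges, h2]
    simp

theorem charFun_map_binomialRandom {n : ℕ} (p : unitInterval) (X : SimpleGraph (Fin n) → ℝ)
    (t : ℝ) :
    charFun ((binomialRandom (Fin n) p).map X) t =
      bernoulliMean (allEdges (Fin n)) p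
        (fun S => Complex.exp ((t * X (ofEdges S) : ℝ) * Complex.I)) := by
  rw [charFun_apply_real, integral_map (Measurable.of_discrete).aemeasurable
    (by fun_prop), integral_binomialRandom]
  push_cast
  rfl

/-! ### Consequences of the two growth conditions on p. -/

section Asymptotics

variable {i : ℕ} {p : ℕ → unitInterval}

theorem eventually_pos_of_isLittleO {a : ℝ}
    (hlow : (fun n : ℕ => (n : ℝ) ^ a) =o[atTop] fun n => (p n : ℝ)) :
    ∀ᶠ n in atTop, 0 < (p n : ℝ) := by
  filter_upwards [hlow.bound one_pos, eventually_gt_atTop 0] with n h hn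
  rw [one_mul, Real.norm_of_nonneg (p n).2.1] at h
  have : 0 < (n : ℝ) := by exact_mod_cast hn
  exact (norm_pos_iff.2 (Real.rpow_pos_of_pos this a).ne').trans_le h

theorem rpow_neg_one_div_pow (n : ℕ) {k : ℕ} (hk : k ≠ 0) :
    ((n : ℝ) ^ (-(1 / (k : ℝ)))) ^ k = (n : ℝ)⁻¹ := by
  rw [← Real.rpow_natCast, ← Real.rpow_mul n.cast_nonneg, ← Real.rpow_neg_one]
  congr 1
  field_simp

theorem tendsto_mul_pow_atTop {k : ℕ} (hk : 0 < k)
    (hlow : (fun n : ℕ => (n : ℝ) ^ (-(1 / (k : ℝ)))) =o[atTop] fun n => (p n : ℝ)) :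
    Tendsto (fun n : ℕ => n * (p n : ℝ) ^ k) atTop atTop := by
  have h := (hlow.pow hk).tendsto_div_nhds_zero
  have hpos : ∀ᶠ n : ℕ in atTop, 0 < ((n : ℝ) ^ (-(1 / (k : ℝ)))) ^ k / (p n : ℝ) ^ k := by
    filter_upwards [eventually_pos_of_isLittleO hlow, eventually_gt_atTop 0] with n h1 h2
    have : 0 < (n : ℝ) := by exact_mod_cast h2
    positivity
  have h2 := (tendsto_nhdsWithin_iff.2 ⟨h, hpos⟩).inv_tendsto_nhdsGT_zero
  refine h2.congr fun n => ?_
  simp only [Pi.inv_apply]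
  rw [rpow_neg_one_div_pow n hk.ne', inv_div, div_inv_eq_mul, mul_comm]

theorem tendsto_mul_pow_zero {k : ℕ}
    (hup : (fun n : ℕ => (p n : ℝ)) =o[atTop] fun n => (n : ℝ) ^ (-(1 / ((k : ℝ) + 1)))) :
    Tendsto (fun n : ℕ => n * (p n : ℝ) ^ (k + 1)) atTop (𝓝 0) := by
  have h := (hup.pow k.succ_pos).tendsto_div_nhds_zero
  refine h.congr fun n => ?_
  have := rpow_neg_one_div_pow n k.succ_ne_zero
  push_cast at this
  rw [this, div_inv_eq_mul, mul_comm]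

theorem tendsto_zero_of_isLittleO_rpow {a : ℝ} (ha : 0 < a)
    (hup : (fun n : ℕ => (p n : ℝ)) =o[atTop] fun n => (n : ℝ) ^ (-a)) :
    Tendsto (fun n => (p n : ℝ)) atTop (𝓝 0) :=
  hup.trans_tendsto ((tendsto_rpow_neg_atTop ha).comp tendsto_natCast_atTop_atTop)

theorem tendsto_linearizationError
    (hw : Tendsto (fun n : ℕ => n * (p n : ℝ) ^ (i + 1)) atTop atTop)
    (hv : Tendsto (fun n : ℕ => n * (p n : ℝ) ^ (i + 2)) atTop (𝓝 0))
    (hp : Tendsto (fun n => (p n : ℝ)) atTop (𝓝 0)) :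
    Tendsto (fun n => linearizationError n i (p n)) atTop (𝓝 0) := by
  have h1 := hw.const_div_atTop (i * 2 ^ (i + 2) * (2 ^ i * i.factorial) ^ 2)
  have h2 := (Real.tendsto_sqrt_atTop.comp hw).const_div_atTop (((i + 2).choose 2 : ℝ) + 4)
  have h3 := ((hv.pow 2).add hv).add hp
  have h := (((h1.const_mul 2).add (h2.const_mul 2)).add
    (h3.const_mul (((i : ℝ) + 2) * 2 ^ (i + 3) * (2 ^ i * i.factorial) ^ 2))).const_mul 3
  simp only [mul_zero, add_zero, ne_eq, OfNat.ofNat_ne_zero, not_false_eq_true, zero_pow] at h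
  exact h

theorem tendsto_edge_variance_atTop
    (hw : Tendsto (fun n : ℕ => n * (p n : ℝ) ^ (i + 1)) atTop atTop)
    (hp : Tendsto (fun n => (p n : ℝ)) atTop (𝓝 0)) :
    Tendsto (fun n : ℕ => n.choose 2 * (p n : ℝ) * (1 - p n)) atTop atTop := by
  -- The constant is the product of `n.choose 2 ≥ n / 2` and `1 - p n ≥ 1 / 2`.
  refine tendsto_atTop_mono' _ ?_ (hw.const_mul_atTop (by norm_num : (0 : ℝ) < 1 / 4))
  filter_upwards [eventually_ge_atTop 2, hp.eventually_le_const (by norm_num : (0 : ℝ) < 1 / 2)]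
    with n hn hpn
  have h0 : 0 ≤ (p n : ℝ) := (p n).2.1
  have hN : (n : ℝ) ≤ 2 * n.choose 2 := by
    have h : n ≤ 2 * n.choose 2 := by
      obtain ⟨m, rfl⟩ := Nat.exists_eq_add_of_le' hn
      rw [two_mul_choose_two]
      exact Nat.le_mul_of_pos_right _ (by omega)
    exact_mod_cast h
  have hpow : (p n : ℝ) ^ (i + 1) ≤ p n := pow_le_of_le_one h0 (p n).2.2 (by omega)
  calc 1 / 4 * (n * (p n : ℝ) ^ (i + 1)) ≤ 1 / 4 * (2 * n.choose 2 * p n) := by gcongr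
    _ = n.choose 2 * (p n : ℝ) * (1 / 2) := by ring
    _ ≤ n.choose 2 * (p n : ℝ) * (1 - p n) := by gcongr; linarith

end Asymptotics

end SimpleGraph

/-! ### Convergence of characteristic functions and the central limit theorem. -/

open SimpleGraph Finset Topology in
theorem tendsto_charFun_cliqueBetti {i : ℕ} {p : ℕ → unitInterval}
    (hw : Tendsto (fun n : ℕ => n * (p n : ℝ) ^ (i + 1)) atTop atTop)
    (hv : Tendsto (fun n : ℕ => n * (p n : ℝ) ^ (i + 2)) atTop (𝓝 0))
    (hp : Tendsto (fun n => (p n : ℝ)) atTop (𝓝 0)) (hpos : ∀ᶠ n in atTop, 0 < (p n : ℝ)) (t : ℝ) :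
    Tendsto (fun n => charFun ((binomialRandom (Fin n) (p n)).map fun G =>
      (cliqueBetti n (i + 1) G - ∫ H, cliqueBetti n (i + 1) H ∂binomialRandom (Fin n) (p n)) /
        √(variance (cliqueBetti n (i + 1)) (binomialRandom (Fin n) (p n)))) t) atTop
      (𝓝 (Complex.exp (-(t ^ 2 / 2)))) := by
  have hε := tendsto_linearizationError hw hv hp
  have hs := Real.tendsto_sqrt_atTop.comp (tendsto_edge_variance_atTop hw hp)
  set s : ℕ → ℝ := Real.sqrt ∘ fun n : ℕ => n.choose 2 * (p n : ℝ) * (1 - p n) with hsdef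
  have hbound : Tendsto (fun n => |t| * √(2 * linearizationError n i (p n)) +
      (3 * |t| ^ 3 / s n + t ^ 4 / s n ^ 2)) atTop (𝓝 0) := by
    have h1 : Tendsto (fun n => √(2 * linearizationError n i (p n))) atTop (𝓝 0) := by
      simpa using (hε.const_mul 2).sqrt
    have h2 := hs.const_div_atTop (3 * |t| ^ 3)
    have h3 := ((tendsto_pow_atTop two_ne_zero).comp hs).const_div_atTop (t ^ 4)
    simpa using (h1.const_mul |t|).add (h2.add h3)
  refine tendsto_iff_norm_sub_tendsto_zero.2 (squeeze_zero' (.of_forall fun n => norm_nonneg _) ?_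
    hbound)
  filter_upwards [eventually_ge_atTop (2 * (i + 2)), hpos, hw.eventually_ge_atTop 1,
    hs.eventually_ge_atTop |t|, hs.eventually_gt_atTop 0,
    hε.eventually_le_const (by norm_num : (0 : ℝ) < 1 / 4)] with n hn hp0 hw1 hst hs0 hε1
  have hs2 : s n ^ 2 = n.choose 2 * (p n : ℝ) * (1 - p n) := by
    have h0 : 0 ≤ 1 - (p n : ℝ) := sub_nonneg.2 (p n).2.2
    rw [hsdef]
    exact Real.sq_sqrt (by positivity)
  have key := norm_charFun_edgeBetti_sub_le (V := Fin n) (i := i) (x := p n) (s := s n) (t := t)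
    (by simpa using hn) hp0 (p n).2.2 (by simpa using hw1) hs0 (by simpa using hs2) hst
    (by simpa using hε1)
  rw [Fintype.card_fin] at key
  refine le_trans (le_of_eq ?_) key
  rw [charFun_map_binomialRandom, variance_eq_integral (Measurable.of_discrete).aemeasurable,
    integral_binomialRandom, integral_binomialRandom]
  rfl

theorem theorem2 (k : ℕ) (hk : 0 < k) (p : ℕ → unitInterval)
    (hlow : (fun n : ℕ => (n : ℝ) ^ (-(1 / (k : ℝ)))) =o[atTop] fun n => (p n : ℝ))
    (hup : (fun n : ℕ => (p n : ℝ)) =o[atTop] fun n => (n : ℝ) ^ (-(1 / ((k : ℝ) + 1)))) :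
    TendstoInDistribution
      (fun (n : ℕ) (G : SimpleGraph (Fin n)) =>
        (cliqueBetti n k G - ∫ H, cliqueBetti n k H ∂SimpleGraph.binomialRandom (Fin n) (p n)) /
          √(variance (cliqueBetti n k) (SimpleGraph.binomialRandom (Fin n) (p n))))
      atTop (id : ℝ → ℝ)
      (fun n => SimpleGraph.binomialRandom (Fin n) (p n)) (gaussianReal 0 1) := by
  obtain ⟨i, rfl⟩ := Nat.exists_eq_add_of_le' hk
  refine ⟨fun n => Measurable.of_discrete.aemeasurable, by fun_prop, ?_⟩
  -- Lévy's continuity theorem reduces weak convergence to pointwise convergence of characteristic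
  -- functions.
  refine ProbabilityMeasure.tendsto_iff_tendsto_charFun.2 fun t => ?_
  have h := tendsto_charFun_cliqueBetti (SimpleGraph.tendsto_mul_pow_atTop hk hlow)
    (SimpleGraph.tendsto_mul_pow_zero hup)
    (SimpleGraph.tendsto_zero_of_isLittleO_rpow (by positivity) hup)
    (SimpleGraph.eventually_pos_of_isLittleO hlow) t
  simpa [charFun_gaussianReal, neg_div] using h
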